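/- Let $\rho>0$. On a probability space, let $(E_i)_{i\ge1}$ be i.i.d. exponential random variables with parameter $1$ and let $(B_j)_{j\ge1}$ be i.i.d. exponential random variables with parameter $\rho$, the sequence $(B_j)$ being independent of the sequence $(E_i)$. Put $t_0=0$ and $t_n=\sum_{i=1}^n E_i/i$ for $n\ge1$. For $i\ge 1$ the $i$-th bin is the interval $(t_{i-1},t_i]$, and the $j$-th ball falls into the bin that contains $B_j$. Let $\nu_n$ be the index of the first empty bin when $n$ balls are thrown, that is, the smallest $i\ge1$ such that none of $B_1,\dots,B_n$ lies in $(t_{i-1},t_i]$. Then $t_n-\log n$ converges almost surely to a finite random variable $M_\infty$ and, with $W_\infty=e^{-M_\infty}$, for every $x\ge0$, $$\lim_{n\to+\infty}\mathbb P\left(\frac{\nu_n}{n^{1/(\rho+2)}}\ge x\right)=\mathbb E\left[\exp\left(-\frac{x^{\rho+2}\,W_\infty^{-\rho}}{\rho(\rho+2)}\right)\right].$$ -/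

import Mathlib

open MeasureTheory ProbabilityTheory Filter Topology

/-- The split times `t_n = ∑_{i=1}^n E_i / i`. Here `E i` plays the role of `E_{i+1}`; in
particular `t_0 = 0`. -/
noncomputable def splitTime {Ω : Type*} (E : ℕ → Ω → ℝ) (n : ℕ) (ω : Ω) : ℝ :=
  ∑ i ∈ Finset.range n, E i ω / ((i : ℝ) + 1)

/-- The `i`-th bin, `i ≥ 1`, is the interval `(t_{i-1}, t_i]`. -/
def bin {Ω : Type*} (E : ℕ → Ω → ℝ) (i : ℕ) (ω : Ω) : Set ℝ :=
  Set.Ioc (splitTime E (i - 1) ω) (splitTime E i ω)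

/-- The index `ν_n` of the first empty bin when the first `n` balls, located at
`B 0, …, B (n - 1)`, have been thrown. When all `E i ω ≥ 0` the bins are disjoint, so at most `n`
of them are occupied and the set below is nonempty. -/
noncomputable def firstEmptyBin {Ω : Type*} (E B : ℕ → Ω → ℝ) (n : ℕ) (ω : Ω) : ℕ :=
  sInf {i : ℕ | 1 ≤ i ∧ ∀ j < n, B j ω ∉ bin E i ω}

/-- `M_n = t_n - log n`. -/
noncomputable def centeredSplitTime {Ω : Type*} (E : ℕ → Ω → ℝ) (n : ℕ) (ω : Ω) : ℝ :=
  splitTime E n ω - Real.log n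

/-- The pointwise limit `M_∞` of `M_n` (meaningful at those `ω` where the limit exists). -/
noncomputable def centeredSplitTimeLimit {Ω : Type*} (E : ℕ → Ω → ℝ) (ω : Ω) : ℝ :=
  limUnder atTop (fun n : ℕ => centeredSplitTime E n ω)

/-- `W_∞ = exp (-M_∞)`. -/
noncomputable def wInfinity {Ω : Type*} (E : ℕ → Ω → ℝ) (ω : Ω) : ℝ :=
  Real.exp (-centeredSplitTimeLimit E ω)

/-! Fix the bins first. The event `x ≤ ν_n / n^(1/(ρ+2))` says that the first `m = ⌈x n^(1/(ρ+2))⌉ -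
1` bins are all occupied. Occupancies of disjoint bins are negatively correlated, so this
probability is at most the product of the individual occupation probabilities with `n` balls. It is
at least the same product with `n - m` balls, since at most `m` balls are used up by the other bins.
As `m = o(n)`, both products have the same limit (`measureReal_hitSet_range_bounds`,
`tendsto_sub_div`).

It remains to average over the bins. With indices from `0`, bin `i` has mass `exp (-ρ t_i) (1 - exp
(-ρ E_i / (i+1)))`. It stays empty essentially only if `E_i` is exceptionally small. Integrating
over `E_i` alone, given the past, the probability that `N` balls avoid it is about `(i+1) exp (ρ
t_i) / (ρ N) = w_i ξ_i`, where `w_i = (i+1)^(ρ+1) / (ρ N)` and `ξ_i = (i+1)^(-ρ) exp (ρ t_i)`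
(`abs_integral_avoidProb_sub_le`). Since `t_i - log i` converges (an `L²`-bounded martingale plus
the harmonic asymptotics), `ξ_i` tends to `V = W_∞^(-ρ)`, while `∑ w_i` over `i < m` tends to `c =
x^(ρ+2) / (ρ(ρ+2))`.

To pass from conditional means to the expectation of the product, freeze `ξ` at a large index `k`
and replace the factors beyond `k`, one at a time, by `exp (-w_j ξ_k)`. The total error is a sum of
mean conditional biases (`abs_integral_prod_sub_prod_le`). The product becomes `exp (-ξ_k ∑ w_j)`,
close to `exp (-c V)`. All this is done with `ξ` capped at a level `K`; the cap is removed at the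
end because convergent sequences are bounded (`tendsto_integral_prod_binProb`). -/

/-! ### Negative correlation of occupancies, from the recursion alone. -/

/-- The occupancy recursion, obtained by looking at the bin of the last ball: `f n S` is the
probability that `n` balls hit every bin of `S`, where `p i` is the weight of bin `i`. -/
def OccupancyRec (p : ℕ → ℝ) (f : ℕ → Finset ℕ → ℝ) : Prop :=
  ∀ n S, f (n + 1) S = (1 - ∑ i ∈ S, p i) * f n S + ∑ i ∈ S, p i * f n (S.erase i)

/-- Negative correlation: balls used to hit `S` are lost for `b`. Induction on the number of balls,
splitting according to the bin of the last one. -/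
theorem OccupancyRec.insert_le {p : ℕ → ℝ} {f : ℕ → Finset ℕ → ℝ} (hf : OccupancyRec p f)
    (hp0 : ∀ i, 0 ≤ p i) (hp1 : ∀ S : Finset ℕ, ∑ i ∈ S, p i ≤ 1)
    (hmono : ∀ n S, f n S ≤ f (n + 1) S) (h0' : ∀ S, S.Nonempty → f 0 S = 0) (b : ℕ) :
    ∀ n (S : Finset ℕ), b ∉ S → f n (insert b S) ≤ f n S * (1 - (1 - p b) ^ n) := by
  intro n
  induction n with
  | zero => intro S _; simp [h0' (insert b S) (by simp)]
  | succ n ih =>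
    intro S hb
    have hr : 0 ≤ 1 - p b := by have := hp1 {b}; simp at this; linarith
    have hP : 0 ≤ 1 - (p b + ∑ i ∈ S, p i) := by
      have := hp1 (insert b S); rw [Finset.sum_insert hb] at this; linarith
    have hR : 0 ≤ (1 - p b) ^ n := by positivity
    have e1 : f (n + 1) (insert b S) = (1 - (p b + ∑ i ∈ S, p i)) * f n (insert b S)
        + (p b * f n S + ∑ i ∈ S, p i * f n (insert b (S.erase i))) := by
      rw [hf n (insert b S), Finset.sum_insert hb, Finset.sum_insert hb, Finset.erase_insert hb]
      congr 2
      refine Finset.sum_congr rfl fun i hi => ?_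
      rw [Finset.erase_insert_of_ne (by rintro rfl; exact hb hi)]
    have e2 : ∑ i ∈ S, p i * f n (insert b (S.erase i))
        ≤ (∑ i ∈ S, p i * f n (S.erase i)) * (1 - (1 - p b) ^ n) := by
      rw [Finset.sum_mul]
      refine Finset.sum_le_sum fun i _ => ?_
      rw [mul_assoc]
      exact mul_le_mul_of_nonneg_left (ih _ (by simp [hb])) (hp0 i)
    have e3 := mul_le_mul_of_nonneg_left (ih S hb) hP
    have e4 := mul_le_mul_of_nonneg_left (hmono n S) (mul_nonneg hR (hp0 b))
    have e5 := hf n S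
    set A := ∑ i ∈ S, p i * f n (S.erase i)
    have : f (n + 1) S * (1 - (1 - p b) ^ (n + 1))
        = (1 - (1 - p b) ^ n) * f (n + 1) S + (1 - p b) ^ n * p b * f (n + 1) S := by ring
    rw [this, e1]
    -- The induction hypothesis leaves `(1 - p b) ^ n * p b * f n S`, where the target has `f (n +
    -- 1) S`; monotonicity in the number of balls closes this gap.
    refine le_trans ?_ (add_le_add_right e4 _)
    rw [e5]
    linarith

/-- Converse bound: hitting `S` requires no more than `S.card` balls, and the other `n - S.card`
remain available for `b`. -/
theorem OccupancyRec.le_insert {p : ℕ → ℝ} {f : ℕ → Finset ℕ → ℝ} (hf : OccupancyRec p f)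
    (hp0 : ∀ i, 0 ≤ p i) (hp1 : ∀ S : Finset ℕ, ∑ i ∈ S, p i ≤ 1)
    (hf0 : ∀ n S, 0 ≤ f n S) (b : ℕ) :
    ∀ n (S : Finset ℕ), b ∉ S →
      f n S * (1 - (1 - p b) ^ (n - S.card)) ≤ f n (insert b S) := by
  intro n
  induction n with
  | zero => intro S _; simpa using hf0 _ _
  | succ n ih =>
    intro S hb
    rcases Nat.lt_or_ge n S.card with hn | hn
    · rw [Nat.sub_eq_zero_of_le hn]; simpa using hf0 _ _
    have hr : 0 ≤ 1 - p b := by have := hp1 {b}; simp at this; linarith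
    have hP : 0 ≤ 1 - (p b + ∑ i ∈ S, p i) := by
      have := hp1 (insert b S); rw [Finset.sum_insert hb] at this; linarith
    have hR : 0 ≤ (1 - p b) ^ (n - S.card) := by positivity
    have hS : 0 ≤ ∑ i ∈ S, p i := Finset.sum_nonneg fun i _ => hp0 i
    have e1 : f (n + 1) (insert b S) = (1 - (p b + ∑ i ∈ S, p i)) * f n (insert b S)
        + (p b * f n S + ∑ i ∈ S, p i * f n (insert b (S.erase i))) := by
      rw [hf n (insert b S), Finset.sum_insert hb, Finset.sum_insert hb, Finset.erase_insert hb]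
      congr 2
      refine Finset.sum_congr rfl fun i hi => ?_
      rw [Finset.erase_insert_of_ne (by rintro rfl; exact hb hi)]
    have e2 : (∑ i ∈ S, p i * f n (S.erase i)) * (1 - (1 - p b) ^ (n + 1 - S.card))
        ≤ ∑ i ∈ S, p i * f n (insert b (S.erase i)) := by
      rw [Finset.sum_mul]
      refine Finset.sum_le_sum fun i hi => ?_
      rw [mul_assoc]
      have h := ih (S.erase i) (by simp [hb])
      rw [Finset.card_erase_of_mem hi] at h
      have hc : 0 < S.card := Finset.card_pos.2 ⟨i, hi⟩
      -- The bin removed from `S` compensates exactly for the ball already spent.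
      rw [show n - (S.card - 1) = n + 1 - S.card by omega] at h
      exact mul_le_mul_of_nonneg_left h (hp0 i)
    have e3 := mul_le_mul_of_nonneg_left (ih S hb) hP
    rw [show n + 1 - S.card = (n - S.card) + 1 by omega] at e2 ⊢
    rw [e1, hf n S]
    set A := ∑ i ∈ S, p i * f n (S.erase i)
    set R := (1 - p b) ^ (n - S.card) with hRdef
    rw [pow_succ, ← hRdef] at e2 ⊢
    -- This is exactly the slack left once `e2` and `e3` are inserted.
    have e4 : 0 ≤ f n S * (R * p b) * ∑ i ∈ S, p i :=
      mul_nonneg (mul_nonneg (hf0 _ _) (mul_nonneg hR (hp0 b))) hS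
    nlinarith [e2, e3, e4]

theorem OccupancyRec.range_le_prod {p : ℕ → ℝ} {f : ℕ → Finset ℕ → ℝ} (hf : OccupancyRec p f)
    (hp0 : ∀ i, 0 ≤ p i) (hp1 : ∀ S : Finset ℕ, ∑ i ∈ S, p i ≤ 1)
    (hmono : ∀ n S, f n S ≤ f (n + 1) S) (h0 : ∀ n, f n ∅ = 1)
    (h0' : ∀ S, S.Nonempty → f 0 S = 0) (n m : ℕ) :
    f n (Finset.range m) ≤ ∏ i ∈ Finset.range m, (1 - (1 - p i) ^ n) := by
  have hr (i : ℕ) : 0 ≤ 1 - p i := by have := hp1 {i}; simp at this; linarith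
  induction m with
  | zero => simp [h0]
  | succ m ih =>
    rw [Finset.prod_range_succ, Finset.range_add_one]
    refine (hf.insert_le hp0 hp1 hmono h0' m n _ (by simp)).trans ?_
    refine mul_le_mul_of_nonneg_right ih ?_
    have := pow_le_one₀ (n := n) (hr m) (by linarith [hp0 m])
    linarith

theorem OccupancyRec.prod_le_range {p : ℕ → ℝ} {f : ℕ → Finset ℕ → ℝ} (hf : OccupancyRec p f)
    (hp0 : ∀ i, 0 ≤ p i) (hp1 : ∀ S : Finset ℕ, ∑ i ∈ S, p i ≤ 1)
    (hf0 : ∀ n S, 0 ≤ f n S) (h0 : ∀ n, f n ∅ = 1) (n m : ℕ) :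
    ∏ i ∈ Finset.range m, (1 - (1 - p i) ^ (n - m)) ≤ f n (Finset.range m) := by
  have hr (i : ℕ) : 0 ≤ 1 - p i := by have := hp1 {i}; simp at this; linarith
  have hpow (i k : ℕ) : (1 - p i) ^ k ≤ 1 := pow_le_one₀ (hr i) (by linarith [hp0 i])
  have key : ∀ k ≤ m, ∏ i ∈ Finset.range k, (1 - (1 - p i) ^ (n - m))
      ≤ f n (Finset.range k) := by
    intro k
    induction k with
    | zero => simp [h0]
    | succ k ih =>
      intro hk
      rw [Finset.prod_range_succ, Finset.range_add_one]
      refine le_trans ?_ (hf.le_insert hp0 hp1 hf0 k n _ (by simp))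
      refine mul_le_mul (ih (by omega)) ?_ (by linarith [hpow k (n - m)]) (hf0 _ _)
      have : (1 - p k) ^ (n - (Finset.range k).card) ≤ (1 - p k) ^ (n - m) :=
        pow_le_pow_of_le_one (hr k) (by linarith [hp0 k]) (by simp; omega)
      linarith
  exact key m le_rfl

/-! ### The recursion for independent balls and disjoint sets. -/

/-- The event that each set `A i`, `i ∈ S`, is hit by one of the first `n` balls. -/
def hitSet {Ω : Type*} (B : ℕ → Ω → ℝ) (A : ℕ → Set ℝ) (n : ℕ) (S : Finset ℕ) : Set Ω :=
  {ω | ∀ i ∈ S, ∃ j < n, B j ω ∈ A i}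

theorem ProbabilityTheory.iIndepFun.indepFun_past {Ω α : Type*} [MeasurableSpace Ω]
    [MeasurableSpace α] {μ : Measure Ω} {X : ℕ → Ω → α} (hX : iIndepFun X μ)
    (hm : ∀ i, Measurable (X i)) (n : ℕ) :
    IndepFun (fun ω (i : Finset.range n) => X i ω) (X n) μ := by
  have h := hX.indepFun_finset (Finset.range n) {n} (by simp) hm
  exact h.comp measurable_id (measurable_pi_apply (⟨n, by simp⟩ : ({n} : Finset ℕ)))

theorem measurableSet_hitSet {Ω : Type*} [MeasurableSpace Ω] {B : ℕ → Ω → ℝ} {A : ℕ → Set ℝ}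
    (hB : ∀ j, Measurable (B j)) (hA : ∀ i, MeasurableSet (A i)) (n : ℕ) (S : Finset ℕ) :
    MeasurableSet (hitSet B A n S) := by
  have : hitSet B A n S = ⋂ i ∈ S, ⋃ j ∈ Finset.range n, B j ⁻¹' A i := by
    ext ω; simp [hitSet]
  rw [this]
  exact Finset.measurableSet_biInter _ fun i _ => Finset.measurableSet_biUnion _ fun j _ =>
    hB j (hA i)

theorem measureReal_hitSet_inter {Ω : Type*} [MeasurableSpace Ω] {μ : Measure Ω}
    {B : ℕ → Ω → ℝ} {A : ℕ → Set ℝ}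
    (hB : ∀ j, Measurable (B j)) (hA : ∀ i, MeasurableSet (A i)) (hind : iIndepFun B μ)
    (n : ℕ) (S : Finset ℕ) {D : Set ℝ} (hD : MeasurableSet D) :
    μ.real (hitSet B A n S ∩ B n ⁻¹' D) = μ.real (hitSet B A n S) * μ.real (B n ⁻¹' D) := by
  have h := hind.indepFun_past hB n
  let H : Set (Finset.range n → ℝ) := ⋂ i ∈ S, ⋃ j : Finset.range n, {y | y j ∈ A i}
  have hH : MeasurableSet H := Finset.measurableSet_biInter _ fun i _ => MeasurableSet.iUnion
    fun j => measurable_pi_apply j (hA i)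
  have e : hitSet B A n S = (fun ω (i : Finset.range n) => B i ω) ⁻¹' H := by
    ext ω; simp [hitSet, H]
  rw [e, measureReal_def, h.measure_inter_preimage_eq_mul _ _ hH hD, ENNReal.toReal_mul]
  rfl

/-- The last ball misses every `A i`, or lies in exactly one of them by disjointness; in the latter
case the earlier balls need only hit the others. Earlier balls are independent of the last one. -/
theorem occupancyRec_hitSet {Ω : Type*} [MeasurableSpace Ω] {μ : Measure Ω}
    [IsProbabilityMeasure μ] {B : ℕ → Ω → ℝ} {A : ℕ → Set ℝ} {p : ℕ → ℝ}
    (hB : ∀ j, Measurable (B j)) (hA : ∀ i, MeasurableSet (A i)) (hind : iIndepFun B μ)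
    (hdisj : Pairwise (Function.onFun Disjoint A)) (hp : ∀ j i, μ.real (B j ⁻¹' A i) = p i) :
    OccupancyRec p fun n S => μ.real (hitSet B A n S) := by
  intro n S
  have hU : MeasurableSet (⋃ i ∈ S, A i) := Finset.measurableSet_biUnion _ fun i _ => hA i
  have hpre : B n ⁻¹' (⋃ i ∈ S, A i) = ⋃ i ∈ S, B n ⁻¹' A i := by simp
  have hpd : (S : Set ℕ).PairwiseDisjoint fun i => B n ⁻¹' A i :=
    fun i _ j _ hij => (hdisj hij).preimage _
  have hsum : μ.real (B n ⁻¹' (⋃ i ∈ S, A i)) = ∑ i ∈ S, p i := by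
    rw [hpre, measureReal_biUnion_finset hpd fun i _ => hB n (hA i)]
    exact Finset.sum_congr rfl fun i _ => hp n i
  have hH := measurableSet_hitSet hB hA
  have hsplit := measureReal_inter_add_sdiff (μ := μ) (s := hitSet B A (n + 1) S)
    (t := B n ⁻¹' (⋃ i ∈ S, A i)) (hB n hU)
  have h1 : hitSet B A (n + 1) S \ B n ⁻¹' (⋃ i ∈ S, A i)
      = hitSet B A n S ∩ B n ⁻¹' (⋃ i ∈ S, A i)ᶜ := by
    ext ω
    simp only [hitSet, Set.mem_sdiff, Set.mem_ofPred_eq, Set.mem_preimage, Set.mem_iUnion,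
      Set.mem_inter_iff, Set.mem_compl_iff, not_exists]
    refine and_congr_left fun hn => forall₂_congr fun i hi => ?_
    constructor
    · rintro ⟨j, hj, hji⟩
      refine ⟨j, lt_of_le_of_ne (Nat.lt_succ_iff.1 hj) ?_, hji⟩
      rintro rfl; exact hn i hi hji
    · rintro ⟨j, hj, hji⟩; exact ⟨j, by omega, hji⟩
  have h2 : hitSet B A (n + 1) S ∩ B n ⁻¹' (⋃ i ∈ S, A i)
      = ⋃ i ∈ S, (hitSet B A n (S.erase i) ∩ B n ⁻¹' A i) := by
    ext ω
    simp only [hitSet, Set.mem_inter_iff, Set.mem_ofPred_eq, Set.mem_preimage, Set.mem_iUnion,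
      Finset.mem_erase, exists_prop]
    constructor
    · rintro ⟨h, i, hi, hin⟩
      refine ⟨i, hi, ?_, hin⟩
      rintro l ⟨hli, hl⟩
      obtain ⟨j, hj, hjl⟩ := h l hl
      refine ⟨j, lt_of_le_of_ne (Nat.lt_succ_iff.1 hj) ?_, hjl⟩
      rintro rfl
      exact Set.disjoint_left.1 (hdisj hli) hjl hin
    · rintro ⟨i, hi, h, hin⟩
      refine ⟨fun l hl => ?_, i, hi, hin⟩
      by_cases hli : l = i
      · exact ⟨n, by omega, hli ▸ hin⟩
      · obtain ⟨j, hj, hjl⟩ := h l ⟨hli, hl⟩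
        exact ⟨j, by omega, hjl⟩
  have hcompl : μ.real (B n ⁻¹' (⋃ i ∈ S, A i)ᶜ) = 1 - ∑ i ∈ S, p i := by
    rw [Set.preimage_compl, probReal_compl_eq_one_sub (hB n hU), hsum]
  rw [h1, h2, measureReal_hitSet_inter hB hA hind n S hU.compl, hcompl,
    measureReal_biUnion_finset (fun i hi j hj hij =>
      ((hpd hi hj hij).mono Set.inter_subset_right Set.inter_subset_right))
      (fun i _ => (hH n _).inter (hB n (hA i)))] at hsplit
  beta_reduce
  rw [← hsplit, add_comm, mul_comm]
  congr 1
  refine Finset.sum_congr rfl fun i _ => ?_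
  rw [measureReal_hitSet_inter hB hA hind n _ (hA i), hp n i, mul_comm]

/-- Two-sided product bounds for the probability that `n` independent balls hit all of the
disjoint sets `A 0, …, A (m - 1)`. -/
theorem measureReal_hitSet_range_bounds {Ω : Type*} [MeasurableSpace Ω] {μ : Measure Ω}
    [IsProbabilityMeasure μ] {B : ℕ → Ω → ℝ} {A : ℕ → Set ℝ} {p : ℕ → ℝ}
    (hB : ∀ j, Measurable (B j)) (hA : ∀ i, MeasurableSet (A i)) (hind : iIndepFun B μ)
    (hdisj : Pairwise (Function.onFun Disjoint A)) (hp : ∀ j i, μ.real (B j ⁻¹' A i) = p i)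
    (n m : ℕ) :
    ∏ i ∈ Finset.range m, (1 - (1 - p i) ^ (n - m)) ≤ μ.real (hitSet B A n (Finset.range m)) ∧
    μ.real (hitSet B A n (Finset.range m)) ≤ ∏ i ∈ Finset.range m, (1 - (1 - p i) ^ n) := by
  have hrec := occupancyRec_hitSet (μ := μ) hB hA hind hdisj hp
  have hp0 (i : ℕ) : 0 ≤ p i := hp 0 i ▸ measureReal_nonneg
  have hp1 (S : Finset ℕ) : ∑ i ∈ S, p i ≤ 1 := by
    have hpd : (S : Set ℕ).PairwiseDisjoint fun i => B 0 ⁻¹' A i :=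
      fun i _ j _ hij => (hdisj hij).preimage _
    have := measureReal_biUnion_finset (μ := μ) hpd fun i _ => hB 0 (hA i)
    rw [← Finset.sum_congr rfl fun i _ => hp 0 i, ← this]
    exact measureReal_le_one
  have h0 (n : ℕ) : μ.real (hitSet B A n ∅) = 1 := by simp [hitSet]
  refine ⟨hrec.prod_le_range hp0 hp1 (fun _ _ => measureReal_nonneg) h0 n m,
    hrec.range_le_prod hp0 hp1 (fun n S => ?_) h0 (fun S hS => ?_) n m⟩
  · exact measureReal_mono fun ω h i hi => (h i hi).imp fun j hj => ⟨by omega, hj.2⟩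
  · obtain ⟨i, hi⟩ := hS
    have : hitSet B A 0 S = ∅ := by
      ext ω; simp only [hitSet, Set.mem_ofPred_eq, Set.mem_empty_iff_false, iff_false]
      intro h; obtain ⟨j, hj, _⟩ := h i hi; omega
    simp [this]

/-! ### Exponential integrals and the mean avoidance probability. -/

theorem integral_expMeasure {r : ℝ} (hr : 0 < r) (f : ℝ → ℝ) :
    ∫ x, f x ∂(expMeasure r) = ∫ x in Set.Ioi 0, r * Real.exp (-(r * x)) * f x := by
  have h1 : expMeasure r =
      volume.withDensity fun x => ENNReal.ofReal (exponentialPDFReal r x) := rfl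
  have h2 (x : ℝ) : ENNReal.ofReal (exponentialPDFReal r x) = exponentialPDF r x := rfl
  rw [h1, integral_withDensity_eq_integral_toReal_smul
    (measurable_exponentialPDFReal r).ennreal_ofReal (by simp),
    ← integral_indicator measurableSet_Ioi]
  simp only [h2]
  refine integral_congr_ae ?_
  filter_upwards [compl_mem_ae_iff.2 (measure_singleton (0 : ℝ))] with x hx
  rcases lt_trichotomy x 0 with h | h | h
  · simp [exponentialPDF_of_neg h, h.le]
  · exact absurd h hx
  · rw [exponentialPDF_of_nonneg h.le, ENNReal.toReal_ofReal (by positivity),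
      Set.indicator_of_mem (by exact h), smul_eq_mul]

theorem integrable_expMeasure_iff {r : ℝ} (hr : 0 < r) (f : ℝ → ℝ) :
    Integrable f (expMeasure r) ↔
      IntegrableOn (fun x => r * Real.exp (-(r * x)) * f x) (Set.Ioi 0) := by
  have h1 : expMeasure r =
      volume.withDensity fun x => ENNReal.ofReal (exponentialPDFReal r x) := rfl
  have h2 (x : ℝ) : ENNReal.ofReal (exponentialPDFReal r x) = exponentialPDF r x := rfl
  rw [h1, integrable_withDensity_iff_integrable_smul'
    (measurable_exponentialPDFReal r).ennreal_ofReal (by simp),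
    ← integrable_indicator_iff measurableSet_Ioi]
  simp only [h2]
  refine integrable_congr ?_
  filter_upwards [compl_mem_ae_iff.2 (measure_singleton (0 : ℝ))] with x hx
  rcases lt_trichotomy x 0 with h | h | h
  · simp [exponentialPDF_of_neg h, h.le]
  · exact absurd h hx
  · rw [exponentialPDF_of_nonneg h.le, ENNReal.toReal_ofReal (by positivity),
      Set.indicator_of_mem (by exact h), smul_eq_mul]

/-- The probability that one of `N` balls avoids a bin of weight `s (1 - exp (-l z))`. -/
noncomputable def avoidProb (l s : ℝ) (N : ℕ) (z : ℝ) : ℝ :=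
  (1 - s * (1 - Real.exp (-(l * |z|)))) ^ N

/-- The absolute value in `avoidProb` makes these bounds hold for every `z`, not just almost surely
under the exponential law. -/
theorem avoidBase_mem {l s : ℝ} (hl : 0 ≤ l) (hs0 : 0 ≤ s) (hs1 : s ≤ 1) (z : ℝ) :
    0 ≤ 1 - s * (1 - Real.exp (-(l * |z|))) ∧ 1 - s * (1 - Real.exp (-(l * |z|))) ≤ 1 := by
  have h1 : Real.exp (-(l * |z|)) ≤ 1 :=
    Real.exp_le_one_iff.2 (neg_nonpos.2 (mul_nonneg hl (abs_nonneg z)))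
  have h2 := Real.exp_pos (-(l * |z|))
  constructor <;> nlinarith

theorem avoidProb_nonneg {l s : ℝ} (hl : 0 ≤ l) (hs0 : 0 ≤ s) (hs1 : s ≤ 1) (N : ℕ) (z : ℝ) :
    0 ≤ avoidProb l s N z := pow_nonneg (avoidBase_mem hl hs0 hs1 z).1 N

theorem avoidProb_le_one {l s : ℝ} (hl : 0 ≤ l) (hs0 : 0 ≤ s) (hs1 : s ≤ 1) (N : ℕ) (z : ℝ) :
    avoidProb l s N z ≤ 1 :=
  pow_le_one₀ (avoidBase_mem hl hs0 hs1 z).1 (avoidBase_mem hl hs0 hs1 z).2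

theorem integrable_avoidProb {l s : ℝ} (hl : 0 ≤ l) (hs0 : 0 ≤ s) (hs1 : s ≤ 1) (N : ℕ)
    (ν : Measure ℝ) [IsFiniteMeasure ν] : Integrable (avoidProb l s N) ν := by
  refine Integrable.of_bound (C := 1) (by unfold avoidProb; fun_prop) (ae_of_all _ fun z => ?_)
  rw [Real.norm_of_nonneg (avoidProb_nonneg hl hs0 hs1 N z)]
  exact avoidProb_le_one hl hs0 hs1 N z

/-- Convexity of `exp` bounds the base below by `exp (-s l x)`, which leaves a pure exponential
integral. -/
theorem le_integral_avoidProb {l s : ℝ} (hl : 0 ≤ l) (hs0 : 0 ≤ s) (hs1 : s ≤ 1) (N : ℕ) :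
    1 / (1 + N * s * l) ≤ ∫ z, avoidProb l s N z ∂(expMeasure 1) := by
  have := isProbabilityMeasure_expMeasure one_pos
  have hc : 0 < 1 + N * s * l := by positivity
  rw [integral_expMeasure one_pos]
  have e1 : ∫ x in Set.Ioi (0 : ℝ), Real.exp (-((1 + N * s * l) * x)) = 1 / (1 + N * s * l) := by
    have := integral_exp_mul_Ioi (a := -(1 + N * s * l)) (by linarith) 0
    simp only [neg_mul] at this
    rw [this, mul_zero, neg_zero, Real.exp_zero, neg_div_neg_eq]
  rw [← e1]
  refine setIntegral_mono_on ?_ ?_ measurableSet_Ioi fun x hx => ?_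
  · have := exp_neg_integrableOn_Ioi 0 hc
    simpa only [neg_mul] using this
  · exact (integrable_expMeasure_iff one_pos _).1 (integrable_avoidProb hl hs0 hs1 N _)
  have hx' : 0 < x := hx
  have h2 : Real.exp (-(s * l * x)) ≤ 1 - s * (1 - Real.exp (-(l * |x|))) := by
    have := convexOn_exp.2 (Set.mem_univ 0) (Set.mem_univ (-(l * |x|))) (by linarith : 0 ≤ 1 - s)
      hs0 (by ring)
    simp only [smul_eq_mul, mul_zero, zero_add, Real.exp_zero, abs_of_pos hx'] at this
    rw [abs_of_pos hx']
    calc _ = Real.exp (s * -(l * x)) := by ring_nf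
      _ ≤ _ := this
      _ = _ := by ring
  calc Real.exp (-((1 + N * s * l) * x)) = 1 * Real.exp (-(1 * x)) * Real.exp (-(s * l * x)) ^ N := by
        rw [one_mul, ← Real.exp_nat_mul, ← Real.exp_add]; ring_nf
    _ ≤ _ := by
        unfold avoidProb
        gcongr

/-- For `l ≤ 1` the density `exp (-x)` is at most `exp (-l x)`, and with this weight the integrand
is an exact derivative, with primitive `g`. -/
theorem integral_avoidProb_le {l s : ℝ} (hl : 0 < l) (hl1 : l ≤ 1) (hs0 : 0 < s) (hs1 : s ≤ 1)
    {N : ℕ} (hN : 0 < N) :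
    ∫ z, avoidProb l s N z ∂(expMeasure 1) ≤ 1 / (N * s * l) := by
  have := isProbabilityMeasure_expMeasure one_pos
  have hN' : (0 : ℝ) < N := by exact_mod_cast hN
  set c : ℝ := l * s * (N + 1) with hc
  have hcpos : 0 < c := by positivity
  let g : ℝ → ℝ := fun x => -(1 - s * (1 - Real.exp (-(l * x)))) ^ (N + 1) / c
  let g' : ℝ → ℝ := fun x => Real.exp (-(l * x)) * (1 - s * (1 - Real.exp (-(l * x)))) ^ N
  have hg (x : ℝ) : HasDerivAt g (g' x) x := by
    have h1 : HasDerivAt (fun x => Real.exp (-(l * x))) (Real.exp (-(l * x)) * (-(l * 1))) x :=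
      (((hasDerivAt_id x).const_mul l).neg).exp
    have h2 := (((((h1.const_sub 1).const_mul s).const_sub 1).pow (N + 1)).neg).div_const c
    refine h2.congr_deriv ?_
    simp only [g', hc]
    push_cast
    field_simp
  have hg0 (x : ℝ) (hx : x ∈ Set.Ioi (0 : ℝ)) : 0 ≤ g' x := by
    have := (avoidBase_mem hl.le hs0.le hs1 x).1
    rw [abs_of_pos (show 0 < x from hx)] at this
    exact mul_nonneg (Real.exp_pos _).le (pow_nonneg this N)
  have hlim : Tendsto g atTop (𝓝 (-(1 - s * (1 - 0)) ^ (N + 1) / c)) := by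
    have h0 : Tendsto (fun x : ℝ => Real.exp (-(l * x))) atTop (𝓝 0) :=
      Real.tendsto_exp_neg_atTop_nhds_zero.comp (tendsto_id.const_mul_atTop hl)
    exact ((((h0.const_sub 1).const_mul s).const_sub 1).pow (N + 1)).neg.div_const c
  have hint : IntegrableOn g' (Set.Ioi 0) :=
    integrableOn_Ioi_deriv_of_nonneg' (fun x _ => hg x) hg0 hlim
  have hval := integral_Ioi_of_hasDerivAt_of_nonneg' (fun x _ => hg x) hg0 hlim
  rw [integral_expMeasure one_pos]
  have hle : ∫ x in Set.Ioi (0 : ℝ), 1 * Real.exp (-(1 * x)) * avoidProb l s N x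
      ≤ ∫ x in Set.Ioi (0 : ℝ), g' x := by
    refine setIntegral_mono_on ?_ hint measurableSet_Ioi fun x hx => ?_
    · exact (integrable_expMeasure_iff one_pos _).1 (integrable_avoidProb hl.le hs0.le hs1 N _)
    have hx' : 0 < x := hx
    have h0 := avoidProb_nonneg hl.le hs0.le hs1 N x
    simp only [avoidProb, abs_of_pos hx'] at h0 ⊢
    rw [one_mul]
    refine mul_le_mul_of_nonneg_right (Real.exp_le_exp.2 ?_) h0
    nlinarith
  refine hle.trans ?_
  rw [hval]
  have h1 : 0 ≤ (1 - s * (1 - 0)) ^ (N + 1) / c :=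
    div_nonneg (pow_nonneg (by linarith) _) hcpos.le
  have h2 : g 0 = -(1 / c) := by simp [g, neg_div]
  rw [h2]
  have h3 : 1 / c ≤ 1 / (N * s * l) := by
    apply one_div_le_one_div_of_le (by positivity)
    rw [hc]
    nlinarith [mul_pos hl hs0]
  rw [neg_div]
  linarith

theorem abs_integral_avoidProb_sub_le {l s : ℝ} (hl : 0 < l) (hl1 : l ≤ 1) (hs0 : 0 < s)
    (hs1 : s ≤ 1) {N : ℕ} (hN : 0 < N) :
    |∫ z, avoidProb l s N z ∂(expMeasure 1) - 1 / (N * s * l)| ≤ (1 / (N * s * l)) ^ 2 := by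
  have h1 := le_integral_avoidProb hl.le hs0.le hs1 N
  have h2 := integral_avoidProb_le hl hl1 hs0 hs1 hN
  have hN' : (0 : ℝ) < N := by exact_mod_cast hN
  have hy : 0 < N * s * l := by positivity
  set y := (N : ℝ) * s * l
  rw [abs_sub_comm, abs_of_nonneg (by linarith)]
  have h3 : 1 / y - 1 / (1 + y) ≤ (1 / y) ^ 2 := by
    rw [div_sub_div _ _ hy.ne' (by positivity), div_pow, div_le_div_iff₀ (by positivity) (by positivity)]
    nlinarith [pow_pos hy 2]
  linarith

theorem expMeasure_integrable_sq : Integrable (fun x : ℝ => x ^ 2) (expMeasure 1) := by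
  rw [integrable_expMeasure_iff one_pos]
  have := Real.GammaIntegral_convergent (s := 3) (by norm_num)
  refine this.congr_fun (fun x _ => ?_) measurableSet_Ioi
  norm_num

theorem expMeasure_integral_id : ∫ x, x ∂(expMeasure 1) = 1 := by
  rw [integral_expMeasure one_pos]
  have := Real.Gamma_eq_integral (s := 2) (by norm_num)
  rw [Real.Gamma_two] at this
  refine Eq.trans ?_ this.symm
  refine setIntegral_congr_fun measurableSet_Ioi fun x _ => ?_
  norm_num

theorem expMeasure_integral_sq : ∫ x, x ^ 2 ∂(expMeasure 1) = 2 := by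
  rw [integral_expMeasure one_pos]
  have := Real.Gamma_eq_integral (s := 3) (by norm_num)
  have h3 : Real.Gamma 3 = 2 := by
    rw [show (3 : ℝ) = ((2 : ℕ) : ℝ) + 1 by norm_num, Real.Gamma_nat_eq_factorial]; norm_num
  rw [h3] at this
  refine Eq.trans ?_ this.symm
  refine setIntegral_congr_fun measurableSet_Ioi fun x _ => ?_
  norm_num

theorem expMeasure_real_Ioc {r : ℝ} (hr : 0 < r) {a b : ℝ} (ha : 0 ≤ a) (hab : a ≤ b) :
    (expMeasure r).real (Set.Ioc a b) = Real.exp (-(r * a)) - Real.exp (-(r * b)) := by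
  have := isProbabilityMeasure_expMeasure hr
  rw [← measure_cdf (expMeasure r), measureReal_def, StieltjesFunction.measure_Ioc,
    cdf_expMeasure_eq hr, cdf_expMeasure_eq hr, if_pos ha, if_pos (ha.trans hab),
    ENNReal.toReal_ofReal]
  · ring
  · have : Real.exp (-(r * b)) ≤ Real.exp (-(r * a)) := Real.exp_le_exp.2 (by nlinarith)
    linarith

theorem ae_pos_expMeasure {r : ℝ} (hr : 0 < r) : ∀ᵐ x ∂(expMeasure r), 0 < x := by
  have := isProbabilityMeasure_expMeasure hr
  have h : (expMeasure r) (Set.Iic 0) = 0 := by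
    have : cdf (expMeasure r) 0 = 0 := by rw [cdf_expMeasure_eq hr]; simp
    rw [cdf_eq_real] at this
    simpa [measureReal_def] using (measureReal_eq_zero_iff (by simp)).1 this
  have := compl_mem_ae_iff.2 h
  filter_upwards [this] with x hx
  simpa using hx

/-! ### Conditioning on the past and replacing factors one by one. -/

/-- `F` depends only on the first `n` coordinates of its sequence argument. -/
def DependsOnFirst {β : Type*} (n : ℕ) (F : (ℕ → ℝ) → β) : Prop :=
  ∀ e e' : ℕ → ℝ, (∀ i < n, e i = e' i) → F e = F e'

theorem DependsOnFirst.mono {β : Type*} {n m : ℕ} {F : (ℕ → ℝ) → β} (h : DependsOnFirst n F)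
    (hnm : n ≤ m) : DependsOnFirst m F :=
  fun e e' he => h e e' fun i hi => he i (hi.trans_le hnm)

/-- Fubini for the independent pair (past, `X n`). The finite past is extended by zeros through
`ex`, which does not affect `F`. -/
theorem integral_of_dependsOnFirst {Ω : Type*} [MeasurableSpace Ω] {μ : Measure Ω}
    [IsProbabilityMeasure μ] {X : ℕ → Ω → ℝ} (hX : iIndepFun X μ) (hm : ∀ i, Measurable (X i))
    (n : ℕ) {F : (ℕ → ℝ) → ℝ → ℝ} (hF : Measurable (Function.uncurry F)) {C : ℝ}
    (hC : ∀ e z, |F e z| ≤ C) (hdep : DependsOnFirst n F) :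
    ∫ ω, F (fun i => X i ω) (X n ω) ∂μ = ∫ ω, ∫ z, F (fun i => X i ω) z ∂(μ.map (X n)) ∂μ := by
  classical
  let ex : (Finset.range n → ℝ) → ℕ → ℝ := fun y i =>
    if h : i < n then y ⟨i, Finset.mem_range.2 h⟩ else 0
  have hex : Measurable ex := measurable_pi_iff.2 fun i => by
    by_cases h : i < n
    · simpa only [ex, h, dite_true] using measurable_pi_apply _
    · simp only [ex, h, dite_false, measurable_const]
  let Y : Ω → Finset.range n → ℝ := fun ω i => X i ω
  have hY : Measurable Y := measurable_pi_lambda _ fun i => hm i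
  have hFY (ω : Ω) : F (fun i => X i ω) = F (ex (Y ω)) :=
    hdep _ _ fun i hi => by simp [ex, Y, hi]
  have hlaw := (indepFun_iff_map_prod_eq_prod_map_map hY.aemeasurable (hm n).aemeasurable).1
    (hX.indepFun_past hm n)
  let G : (Finset.range n → ℝ) × ℝ → ℝ := fun p => F (ex p.1) p.2
  have hG : Measurable G := hF.comp ((hex.comp measurable_fst).prodMk measurable_snd)
  have hp1 : IsProbabilityMeasure (μ.map Y) := Measure.isProbabilityMeasure_map hY.aemeasurable
  have hp2 : IsProbabilityMeasure (μ.map (X n)) :=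
    Measure.isProbabilityMeasure_map (hm n).aemeasurable
  have hGi : Integrable G ((μ.map Y).prod (μ.map (X n))) :=
    Integrable.of_bound hG.aestronglyMeasurable C (ae_of_all _ fun p => hC _ _)
  simp_rw [hFY]
  calc ∫ ω, F (ex (Y ω)) (X n ω) ∂μ = ∫ p, G p ∂(μ.map fun ω => (Y ω, X n ω)) := by
        rw [integral_map (hY.prodMk (hm n)).aemeasurable hG.aestronglyMeasurable]
    _ = ∫ y, ∫ z, G (y, z) ∂(μ.map (X n)) ∂(μ.map Y) := by
        rw [hlaw, integral_prod _ hGi]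
    _ = _ := by
        rw [integral_map hY.aemeasurable]
        exact (hG.stronglyMeasurable.integral_prod_right').aestronglyMeasurable

theorem abs_mul_le_one' {a b : ℝ} (ha : |a| ≤ 1) (hb : |b| ≤ 1) : |a * b| ≤ 1 := by
  rw [abs_mul]; exact mul_le_one₀ ha (abs_nonneg b) hb

theorem abs_finset_prod_le_one {ι : Type*} (s : Finset ι) {f : ι → ℝ} (h : ∀ i, |f i| ≤ 1) :
    |∏ i ∈ s, f i| ≤ 1 := by
  rw [Finset.abs_prod]; exact Finset.prod_le_one (fun i _ => abs_nonneg _) fun i _ => h i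

/-- Replacing, inside an expectation, the factors `1 - Q j` of a product by factors `r j` that are
determined by the first `k` coordinates costs at most the sum of the mean conditional biases. -/
theorem abs_integral_prod_sub_prod_le {Ω : Type*} [MeasurableSpace Ω] {μ : Measure Ω}
    [IsProbabilityMeasure μ] {X : ℕ → Ω → ℝ} (hX : iIndepFun X μ) (hm : ∀ i, Measurable (X i))
    {ν : Measure ℝ} (hν : ∀ i, μ.map (X i) = ν)
    {Q : ℕ → (ℕ → ℝ) → ℝ → ℝ} (hQm : ∀ j, Measurable (Function.uncurry (Q j)))
    (hQ0 : ∀ j e z, 0 ≤ Q j e z) (hQ1 : ∀ j e z, Q j e z ≤ 1) (hQd : ∀ j, DependsOnFirst j (Q j))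
    {k : ℕ} {r : ℕ → (ℕ → ℝ) → ℝ} (hrm : ∀ j, Measurable (r j)) (hr1 : ∀ j e, |r j e| ≤ 1)
    (hrd : ∀ j, DependsOnFirst k (r j)) {m : ℕ} (hkm : k ≤ m) :
    ∀ ψ : (ℕ → ℝ) → ℝ, Measurable ψ → (∀ e, |ψ e| ≤ 1) → DependsOnFirst k ψ →
    |∫ ω, ψ (fun i => X i ω) * (∏ j ∈ Finset.Ico k m, (1 - Q j (fun i => X i ω) (X j ω))
        - ∏ j ∈ Finset.Ico k m, r j (fun i => X i ω)) ∂μ|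
      ≤ ∑ j ∈ Finset.Ico k m,
        ∫ ω, |1 - ∫ z, Q j (fun i => X i ω) z ∂ν - r j (fun i => X i ω)| ∂μ := by
  have hXm : Measurable fun ω i => X i ω := measurable_pi_lambda _ hm
  have hνp : IsProbabilityMeasure ν := hν 0 ▸ Measure.isProbabilityMeasure_map (hm 0).aemeasurable
  have hQ' (j e z) : |1 - Q j e z| ≤ 1 := by
    rw [abs_le]; constructor <;> linarith [hQ0 j e z, hQ1 j e z]
  have hAm (j : ℕ) : Measurable fun e => ∫ z, Q j e z ∂ν :=
    ((hQm j).stronglyMeasurable.integral_prod_right (ν := ν)).measurable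
  have hQi (j e) : Integrable (Q j e) ν :=
    Integrable.of_bound ((hQm j).comp measurable_prodMk_left).aestronglyMeasurable 1
      (ae_of_all _ fun z => by rw [Real.norm_of_nonneg (hQ0 j e z)]; exact hQ1 j e z)
  have hA0 (j e) : 0 ≤ ∫ z, Q j e z ∂ν := integral_nonneg (hQ0 j e)
  have hA1 (j e) : ∫ z, Q j e z ∂ν ≤ 1 := by
    have := integral_mono (hQi j e) (integrable_const 1) (hQ1 j e); simpa using this
  have hbd {f : Ω → ℝ} (C : ℝ) (hf : Measurable f) (h : ∀ ω, |f ω| ≤ C) : Integrable f μ :=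
    Integrable.of_bound hf.aestronglyMeasurable C (ae_of_all _ h)
  have hQX (j : ℕ) : Measurable fun e : ℕ → ℝ => 1 - Q j e (e j) :=
    measurable_const.sub ((hQm j).comp (measurable_id.prodMk (measurable_pi_apply j)))
  -- The multiplier `ψ` stays universally quantified: the induction enlarges it by factors `r j`.
  induction m, hkm using Nat.le_induction with
  | base => intro ψ _ _ _; simp
  | succ m hkm ih =>
    intro ψ hψm hψ1 hψd
    set U : (ℕ → ℝ) → ℝ := fun e => ∏ j ∈ Finset.Ico k m, (1 - Q j e (e j)) with hU
    set V : (ℕ → ℝ) → ℝ := fun e => ∏ j ∈ Finset.Ico k m, r j e with hV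
    have hUm : Measurable U := Finset.measurable_prod _ fun j _ => hQX j
    have hVm : Measurable V := Finset.measurable_prod _ fun j _ => hrm j
    have hU1 (e) : |U e| ≤ 1 := abs_finset_prod_le_one _ fun j => hQ' j e _
    have hV1 (e) : |V e| ≤ 1 := abs_finset_prod_le_one _ fun j => hr1 j e
    have hUd : DependsOnFirst m U := fun e e' h => Finset.prod_congr rfl fun j hj => by
      have hj := Finset.mem_Ico.1 hj
      rw [hQd j e e' fun i hi => h i (hi.trans hj.2), h j hj.2]
    rw [Finset.sum_Ico_succ_top hkm]
    let F : (ℕ → ℝ) → ℝ → ℝ := fun e z => ψ e * U e * (1 - Q m e z - r m e)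
    have hFm : Measurable (Function.uncurry F) := by
      have h1 := hψm.comp (measurable_fst : Measurable (Prod.fst : (ℕ → ℝ) × ℝ → ℕ → ℝ))
      have h2 := hUm.comp (measurable_fst : Measurable (Prod.fst : (ℕ → ℝ) × ℝ → ℕ → ℝ))
      have h3 := (hrm m).comp (measurable_fst : Measurable (Prod.fst : (ℕ → ℝ) × ℝ → ℕ → ℝ))
      exact (h1.mul h2).mul ((measurable_const.sub (hQm m)).sub h3)
    have hψU (e) : |ψ e * U e| ≤ 1 := abs_mul_le_one' (hψ1 e) (hU1 e)
    have hFC (e z) : |F e z| ≤ 2 := by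
      rw [abs_mul]
      have h1 : |1 - Q m e z - r m e| ≤ 2 := (abs_sub _ _).trans (by linarith [hQ' m e z, hr1 m e])
      calc _ ≤ 1 * 2 := mul_le_mul (hψU e) h1 (abs_nonneg _) zero_le_one
        _ = 2 := by norm_num
    have hFd : DependsOnFirst m F := fun e e' h => by
      funext z
      simp only [F]
      rw [hψd.mono hkm e e' h, hUd e e' h, hQd m e e' h, (hrd m).mono hkm e e' h]
    have key := integral_of_dependsOnFirst hX hm m hFm hFC hFd
    rw [hν m] at key
    have hinner (e) : ∫ z, F e z ∂ν = ψ e * U e * (1 - ∫ z, Q m e z ∂ν - r m e) := by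
      simp only [F]
      have h1 : Integrable (fun z => 1 - Q m e z) ν := (integrable_const _).sub (hQi m e)
      rw [integral_const_mul, integral_sub h1 (integrable_const _),
        integral_sub (integrable_const _) (hQi m e)]
      simp
    simp_rw [hinner] at key
    -- Telescoping `U (1 - Q) - V r = U (1 - Q - r) + r (U - V)`. The first term is integrated over
    -- `X m` given the past; in the second, `r m` depends on the first `k` coordinates and is
    -- absorbed into `ψ`.
    have hsplit (ω : Ω) : ψ (fun i => X i ω) *
        (∏ j ∈ Finset.Ico k (m + 1), (1 - Q j (fun i => X i ω) (X j ω))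
          - ∏ j ∈ Finset.Ico k (m + 1), r j (fun i => X i ω))
        = F (fun i => X i ω) (X m ω) + (ψ (fun i => X i ω) * r m (fun i => X i ω)) *
          (∏ j ∈ Finset.Ico k m, (1 - Q j (fun i => X i ω) (X j ω))
          - ∏ j ∈ Finset.Ico k m, r j (fun i => X i ω)) := by
      rw [Finset.prod_Ico_succ_top hkm, Finset.prod_Ico_succ_top hkm]
      simp only [F]
      ring
    simp_rw [hsplit]
    rw [integral_add]
    · refine ((abs_add_le _ _).trans (add_le_add ?_ ?_)).trans_eq (add_comm _ _)
      · rw [key]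
        refine (abs_integral_le_integral_abs).trans ?_
        have hb (e) : |1 - ∫ z, Q m e z ∂ν - r m e| ≤ 2 := by
          refine (abs_sub _ _).trans ?_
          have : |1 - ∫ z, Q m e z ∂ν| ≤ 1 := by
            rw [abs_le]; constructor <;> linarith [hA0 m e, hA1 m e]
          linarith [hr1 m e]
        have hmeas : Measurable fun e => 1 - ∫ z, Q m e z ∂ν - r m e :=
          (measurable_const.sub (hAm m)).sub (hrm m)
        refine integral_mono (hbd 2 ?_ fun ω => ?_) (hbd 2 ?_ fun ω => ?_) fun ω => ?_
        · exact (((hψm.mul hUm).mul hmeas).comp hXm).abs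
        · rw [abs_abs, abs_mul]
          calc _ ≤ (1 : ℝ) * 2 := mul_le_mul (hψU _) (hb _) (abs_nonneg _) zero_le_one
            _ = 2 := by norm_num
        · exact (hmeas.comp hXm).abs
        · rw [abs_abs]; exact hb _
        · rw [abs_mul]
          exact mul_le_of_le_one_left (abs_nonneg _) (hψU _)
      · exact ih (fun e => ψ e * r m e) (hψm.mul (hrm m))
          (fun e => abs_mul_le_one' (hψ1 e) (hr1 m e))
          (fun e e' h => by beta_reduce; rw [hψd e e' h, hrd m e e' h])
    · exact hbd 2 (hFm.comp (hXm.prodMk (hm m))) fun ω => hFC _ _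
    · refine hbd 2 ((((hψm.mul (hrm m)).mul (hUm.sub hVm))).comp hXm) fun ω => ?_
      have h1 : |U (fun i => X i ω) - V (fun i => X i ω)| ≤ 2 :=
        (abs_sub _ _).trans (by linarith [hU1 (fun i => X i ω), hV1 (fun i => X i ω)])
      rw [abs_mul]
      calc _ ≤ (1 : ℝ) * 2 := mul_le_mul (abs_mul_le_one' (hψ1 _) (hr1 _ _)) h1 (abs_nonneg _)
            zero_le_one
        _ = 2 := by norm_num

/-! ### Almost sure convergence of the centered split times. -/

/-- Sums of independent centered square-integrable variables with summable variances converge. -/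
theorem ae_exists_tendsto_sum_of_summable_variance {Ω : Type*} [MeasurableSpace Ω] {μ : Measure Ω}
    [IsProbabilityMeasure μ] {X : ℕ → Ω → ℝ} (hX : iIndepFun X μ) (hm : ∀ i, Measurable (X i))
    (hL2 : ∀ i, MemLp (X i) 2 μ) (h0 : ∀ i, ∫ ω, X i ω ∂μ = 0)
    (hv : Summable fun i => variance (X i) μ) :
    ∀ᵐ ω ∂μ, ∃ c, Tendsto (fun n => ∑ i ∈ Finset.range n, X i ω) atTop (𝓝 c) := by
  let ℱ := Filtration.natural X fun i => (hm i).stronglyMeasurable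
  -- The sum runs through index `n`, matching the natural filtration, whose `n`-th σ-algebra
  -- contains `X n`.
  let S : ℕ → Ω → ℝ := fun n ω => ∑ i ∈ Finset.range (n + 1), X i ω
  have hSL2 (n : ℕ) : MemLp (S n) 2 μ := memLp_finsetSum _ fun i _ => hL2 i
  have hadapt : StronglyAdapted ℱ S := fun n => by
    refine Finset.stronglyMeasurable_fun_sum _ fun i hi => ?_
    exact (Filtration.stronglyAdapted_natural fun i => (hm i).stronglyMeasurable).stronglyMeasurable_le
      (Nat.lt_succ_iff.1 (Finset.mem_range.1 hi))
  have hmart : Martingale S ℱ μ := by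
    refine martingale_nat hadapt (fun n => (hSL2 n).integrable one_le_two) fun n => ?_
    have e : S (n + 1) = S n + X (n + 1) := by
      funext ω; simp only [S, Pi.add_apply]; rw [Finset.sum_range_succ _ (n + 1)]
    rw [e]
    have h1 := condExp_add ((hSL2 n).integrable one_le_two) ((hL2 (n + 1)).integrable one_le_two)
      (ℱ n)
    have h2 := hX.condExp_natural_ae_eq_of_lt (fun i => (hm i).stronglyMeasurable) (Nat.lt_succ_self n)
    have h3 := condExp_of_stronglyMeasurable (ℱ.le n) (hadapt n) ((hSL2 n).integrable one_le_two)
    filter_upwards [h1, h2] with ω a b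
    rw [a, Pi.add_apply, h3]
    rw [b, h0]; simp
  have hvar (n : ℕ) : variance (S n) μ ≤ ∑' i, variance (X i) μ := by
    have : variance (S n) μ = ∑ i ∈ Finset.range (n + 1), variance (X i) μ := by
      have := IndepFun.variance_sum (μ := μ) (X := X) (s := Finset.range (n + 1))
        (fun i _ => hL2 i) fun i _ j _ hij => hX.indepFun hij
      rw [← this]; congr 1; funext ω; simp [S]
    rw [this]
    exact hv.sum_le_tsum _ fun i _ => variance_nonneg _ _
  set V := ∑' i, variance (X i) μ
  have hbdd (n : ℕ) : eLpNorm (S n) 1 μ ≤ (Real.toNNReal (1 + V) : ENNReal) := by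
    have hi := (hSL2 n).integrable one_le_two
    have hS0 : ∫ ω, S n ω ∂μ = 0 := by
      simp only [S]
      rw [integral_finsetSum _ fun i _ => (hL2 i).integrable one_le_two]
      simp [h0]
    have hsq := variance_eq_integral (hi.1.aemeasurable) (μ := μ)
    rw [hS0] at hsq
    simp only [sub_zero] at hsq
    rw [eLpNorm_one_eq_lintegral_enorm, ← ofReal_integral_norm_eq_lintegral_enorm hi]
    refine ENNReal.ofReal_le_ofReal ?_
    -- From `|s| ≤ 1 + s ^ 2`: bounded variances give the `L¹` bound required for martingale
    -- convergence.
    have : ∫ ω, ‖S n ω‖ ∂μ ≤ ∫ ω, (1 + S n ω ^ 2) ∂μ := by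
      refine integral_mono hi.norm ((integrable_const 1).add (hSL2 n).integrable_sq) fun ω => ?_
      dsimp only
      rw [Real.norm_eq_abs, ← sq_abs]
      nlinarith [sq_nonneg (|S n ω| - 1)]
    rw [integral_add (integrable_const 1) (hSL2 n).integrable_sq, ← hsq] at this
    have h1 : ∫ _, (1 : ℝ) ∂μ = 1 := by simp
    rw [h1] at this
    linarith [hvar n]
  filter_upwards [hmart.submartingale.exists_ae_tendsto_of_bdd hbdd] with ω ⟨c, hc⟩
  exact ⟨c, (tendsto_add_atTop_iff_nat 1).1 hc⟩

/-- The centered terms `(E i - 1) / (i + 1)` have summable variances `1 / (i + 1) ^ 2`; their means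
sum to the harmonic numbers, which exceed `log n` by Euler's constant in the limit. -/
theorem ae_exists_tendsto_centeredSplitTime {Ω : Type*} [MeasurableSpace Ω] {μ : Measure Ω}
    [IsProbabilityMeasure μ] {E : ℕ → Ω → ℝ} (hE : iIndepFun E μ) (hm : ∀ i, Measurable (E i))
    (hlaw : ∀ i, HasLaw (E i) (expMeasure 1) μ) :
    ∀ᵐ ω ∂μ, ∃ c, Tendsto (fun n => centeredSplitTime E n ω) atTop (𝓝 c) := by
  have hp := isProbabilityMeasure_expMeasure one_pos
  have hL2 (i : ℕ) : MemLp (E i) 2 μ := by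
    rw [memLp_two_iff_integrable_sq (hm i).aestronglyMeasurable]
    have h := expMeasure_integrable_sq
    rw [← (hlaw i).map_eq] at h
    exact (integrable_map_measure (by fun_prop) (hm i).aemeasurable).1 h
  have hmean (i : ℕ) : ∫ ω, E i ω ∂μ = 1 := by
    rw [← expMeasure_integral_id, ← (hlaw i).map_eq,
      integral_map (hm i).aemeasurable (by fun_prop)]
  have hsq (i : ℕ) : ∫ ω, E i ω ^ 2 ∂μ = 2 := by
    rw [← expMeasure_integral_sq, ← (hlaw i).map_eq,
      integral_map (hm i).aemeasurable (by fun_prop)]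
  let X : ℕ → Ω → ℝ := fun i ω => ((i : ℝ) + 1)⁻¹ * (E i ω - 1)
  have hXi : iIndepFun X μ := hE.comp (fun i y => ((i : ℝ) + 1)⁻¹ * (y - 1)) fun i => by fun_prop
  have hvar (i : ℕ) : variance (X i) μ = (((i : ℝ) + 1)⁻¹) ^ 2 := by
    have h1 : variance (E i) μ = 1 := by
      rw [variance_eq_sub (hL2 i)]
      simp only [Pi.pow_apply]
      rw [hsq, hmean]; norm_num
    simp only [X]
    rw [variance_const_mul, variance_sub_const (hm i).aestronglyMeasurable, h1, mul_one]
  have h := ae_exists_tendsto_sum_of_summable_variance hXi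
    (fun i => by simp only [X]; fun_prop)
    (fun i => ((hL2 i).sub (memLp_const 1)).const_mul _)
    (fun i => by
      simp only [X]
      rw [integral_const_mul, integral_sub ((hL2 i).integrable one_le_two) (integrable_const _),
        hmean]
      simp)
    (by
      simp_rw [hvar]
      have := (summable_nat_add_iff 1).2 (Real.summable_nat_pow_inv.2 one_lt_two)
      simpa using this)
  filter_upwards [h] with ω ⟨c, hc⟩
  refine ⟨c + Real.eulerMascheroniConstant, ?_⟩
  refine (hc.add Real.tendsto_harmonic_sub_log).congr fun n => ?_
  simp only [centeredSplitTime, splitTime, harmonic, X]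
  push_cast
  rw [← add_sub_assoc, ← Finset.sum_add_distrib]
  congr 1
  refine Finset.sum_congr rfl fun i _ => ?_
  field_simp
  ring

/-! ### Truncated weights and the conditional bias of one bin. -/

/-- The split times as a function of the sequence of exponential variables; absolute values make
the sequence of times nondecreasing for every argument. -/
noncomputable def splitSum (e : ℕ → ℝ) (n : ℕ) : ℝ := ∑ i ∈ Finset.range n, |e i| / ((i : ℝ) + 1)

theorem splitSum_nonneg (e : ℕ → ℝ) (n : ℕ) : 0 ≤ splitSum e n :=
  Finset.sum_nonneg fun i _ => by positivity

theorem measurable_splitSum (n : ℕ) : Measurable fun e => splitSum e n := by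
  unfold splitSum; fun_prop

theorem splitSum_congr {e e' : ℕ → ℝ} {n : ℕ} (h : ∀ i < n, e i = e' i) :
    splitSum e n = splitSum e' n :=
  Finset.sum_congr rfl fun i hi => by rw [h i (Finset.mem_range.1 hi)]

/-- The weight `exp (-ρ t_i)` beyond the `i`-th split time, truncated from below. -/
noncomputable def tailWeight (ρ K : ℝ) (i : ℕ) (e : ℕ → ℝ) : ℝ :=
  max (Real.exp (-(ρ * splitSum e i))) (((i : ℝ) + 1) ^ (-ρ) / K)

/-- The normalized inverse `(i + 1) ^ (-ρ) exp (ρ t_i)` of the weight. -/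
noncomputable def invWeight (ρ : ℝ) (i : ℕ) (e : ℕ → ℝ) : ℝ :=
  ((i : ℝ) + 1) ^ (-ρ) * Real.exp (ρ * splitSum e i)

theorem invWeight_pos (ρ : ℝ) (i : ℕ) (e : ℕ → ℝ) : 0 < invWeight ρ i e := by
  unfold invWeight; positivity

theorem measurable_invWeight (ρ : ℝ) (i : ℕ) : Measurable (invWeight ρ i) := by
  have := measurable_splitSum i
  unfold invWeight; fun_prop

theorem dependsOnFirst_invWeight (ρ : ℝ) (i : ℕ) : DependsOnFirst i (invWeight ρ i) :=
  fun e e' h => by unfold invWeight; rw [splitSum_congr h]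

theorem measurable_tailWeight (ρ K : ℝ) (i : ℕ) : Measurable (tailWeight ρ K i) := by
  have := measurable_splitSum i
  unfold tailWeight; fun_prop

theorem dependsOnFirst_tailWeight (ρ K : ℝ) (i : ℕ) : DependsOnFirst i (tailWeight ρ K i) :=
  fun e e' h => by unfold tailWeight; rw [splitSum_congr h]

theorem tailWeight_pos (ρ K : ℝ) (i : ℕ) (e : ℕ → ℝ) : 0 < tailWeight ρ K i e :=
  lt_max_of_lt_left (Real.exp_pos _)

theorem tailWeight_le_one {ρ K : ℝ} (hρ : 0 < ρ) (hK : 1 ≤ K) (i : ℕ) (e : ℕ → ℝ) :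
    tailWeight ρ K i e ≤ 1 := by
  refine max_le (Real.exp_le_one_iff.2 ?_) ?_
  · have := mul_nonneg hρ.le (splitSum_nonneg e i); linarith
  · rw [div_le_one (by linarith)]
    refine le_trans (Real.rpow_le_one_of_one_le_of_nonpos ?_ (by linarith)) hK
    linarith [(Nat.cast_nonneg i : (0 : ℝ) ≤ i)]

/-- Truncating the weight from below amounts to capping its normalized inverse at `K`, so all error
terms become bounded while dependence on the past is preserved. -/
theorem div_tailWeight {ρ K : ℝ} (hK : 1 ≤ K) (i : ℕ) (e : ℕ → ℝ) :
    ((i : ℝ) + 1) ^ (-ρ) / tailWeight ρ K i e = min (invWeight ρ i e) K := by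
  have hK0 : 0 < K := by linarith
  have hi : 0 < ((i : ℝ) + 1) ^ (-ρ) := by positivity
  have hx := Real.exp_pos (-(ρ * splitSum e i))
  have h1 : invWeight ρ i e = ((i : ℝ) + 1) ^ (-ρ) / Real.exp (-(ρ * splitSum e i)) := by
    rw [invWeight, Real.exp_neg, div_inv_eq_mul]
  rw [h1, tailWeight]
  rcases le_total (Real.exp (-(ρ * splitSum e i))) (((i : ℝ) + 1) ^ (-ρ) / K) with h | h
  · rw [max_eq_right h, min_eq_right]
    · field_simp
    · rw [le_div_iff₀ hx]; rwa [le_div_iff₀ hK0, mul_comm] at h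
  · rw [max_eq_left h, min_eq_left]
    rw [div_le_iff₀ hx]; rwa [div_le_iff₀ hK0, mul_comm] at h

theorem tailWeight_of_le {ρ K : ℝ} (hK : 1 ≤ K) {i : ℕ} {e : ℕ → ℝ} (h : invWeight ρ i e ≤ K) :
    tailWeight ρ K i e = Real.exp (-(ρ * splitSum e i)) := by
  have hK0 : 0 < K := by linarith
  refine max_eq_left ?_
  rw [div_le_iff₀ hK0, Real.exp_neg, inv_mul_eq_div, le_div_iff₀ (Real.exp_pos _)]
  exact h

theorem abs_one_sub_sub_exp_neg_le {y : ℝ} (hy : 0 ≤ y) : |1 - y - Real.exp (-y)| ≤ y ^ 2 := by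
  rcases le_total y 1 with h | h
  · have := Real.abs_exp_sub_one_sub_id_le (x := -y) (by rw [abs_neg, abs_of_nonneg hy]; exact h)
    rw [show 1 - y - Real.exp (-y) = -(Real.exp (-y) - 1 - -y) by ring, abs_neg]
    simpa only [neg_sq] using this
  · have h1 := Real.add_one_le_exp (-y)
    have h2 : Real.exp (-y) ≤ 1 := Real.exp_le_one_iff.2 (by linarith)
    rw [abs_sub_comm, abs_of_nonneg (by linarith)]
    nlinarith

/-- The first-order weight of the bin `i` when `N` balls are thrown. -/
noncomputable def binWeight (ρ : ℝ) (N i : ℕ) : ℝ := ((i : ℝ) + 1) ^ (ρ + 1) / (ρ * N)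

theorem binWeight_nonneg {ρ : ℝ} (hρ : 0 < ρ) (N i : ℕ) : 0 ≤ binWeight ρ N i := by
  unfold binWeight; positivity

/-- The truncated conditional probability that the bin `i` is avoided by `N` balls. -/
noncomputable def truncAvoid (ρ K : ℝ) (N i : ℕ) (e : ℕ → ℝ) (z : ℝ) : ℝ :=
  avoidProb (ρ / ((i : ℝ) + 1)) (tailWeight ρ K i e) N z

theorem truncAvoid_nonneg {ρ K : ℝ} (hρ : 0 < ρ) (hK : 1 ≤ K) (N i : ℕ) (e : ℕ → ℝ) (z : ℝ) :
    0 ≤ truncAvoid ρ K N i e z :=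
  avoidProb_nonneg (by positivity) (tailWeight_pos _ _ _ _).le (tailWeight_le_one hρ hK i e) N z

theorem truncAvoid_le_one {ρ K : ℝ} (hρ : 0 < ρ) (hK : 1 ≤ K) (N i : ℕ) (e : ℕ → ℝ) (z : ℝ) :
    truncAvoid ρ K N i e z ≤ 1 :=
  avoidProb_le_one (by positivity) (tailWeight_pos _ _ _ _).le (tailWeight_le_one hρ hK i e) N z

theorem measurable_truncAvoid (ρ K : ℝ) (N i : ℕ) :
    Measurable (Function.uncurry (truncAvoid ρ K N i)) := by
  have h : Measurable fun p : (ℕ → ℝ) × ℝ => tailWeight ρ K i p.1 :=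
    (measurable_tailWeight ρ K i).comp measurable_fst
  unfold truncAvoid avoidProb Function.uncurry
  fun_prop

/-- Three errors: the mean avoidance probability against `w a`, the frozen `b` in place of the
current `a`, and `1 - w b` against `exp (-w b)`. The first and third are quadratic in `w`. The
condition on `j` makes the rate `ρ / (j + 1)` at most `1`. -/
theorem abs_bias_le {ρ K : ℝ} (hρ : 0 < ρ) (hK : 1 ≤ K) {N : ℕ} (hN : 0 < N) {k j : ℕ}
    (hj : ρ ≤ (j : ℝ) + 1) (e : ℕ → ℝ) :
    |1 - ∫ z, truncAvoid ρ K N j e z ∂(expMeasure 1)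
        - Real.exp (-(binWeight ρ N j * min (invWeight ρ k e) K))|
      ≤ 2 * K ^ 2 * binWeight ρ N j ^ 2
        + binWeight ρ N j * |min (invWeight ρ j e) K - min (invWeight ρ k e) K| := by
  have hN' : (0 : ℝ) < N := by exact_mod_cast hN
  have hj0 : (0 : ℝ) < (j : ℝ) + 1 := by positivity
  have hw := binWeight_nonneg hρ N j
  have hs := tailWeight_pos ρ K j e
  have h1 := abs_integral_avoidProb_sub_le (l := ρ / ((j : ℝ) + 1)) (by positivity)
    ((div_le_one hj0).2 hj) hs (tailWeight_le_one hρ hK j e) hN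
  have e1 : 1 / (N * tailWeight ρ K j e * (ρ / ((j : ℝ) + 1)))
      = binWeight ρ N j * min (invWeight ρ j e) K := by
    rw [← div_tailWeight hK, binWeight, Real.rpow_add hj0, Real.rpow_neg hj0.le, Real.rpow_one]
    have := Real.rpow_pos_of_pos hj0 ρ
    field_simp
  rw [e1] at h1
  set w := binWeight ρ N j
  set a := min (invWeight ρ j e) K
  set b := min (invWeight ρ k e) K
  have ha0 : 0 ≤ a := le_min (invWeight_pos _ _ _).le (by linarith)
  have hb0 : 0 ≤ b := le_min (invWeight_pos _ _ _).le (by linarith)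
  have haK : a ≤ K := min_le_right _ _
  have hbK : b ≤ K := min_le_right _ _
  have h2 := abs_one_sub_sub_exp_neg_le (mul_nonneg hw hb0)
  have h3 : (w * a) ^ 2 ≤ K ^ 2 * w ^ 2 := by rw [mul_pow, mul_comm]; gcongr
  have h4 : (w * b) ^ 2 ≤ K ^ 2 * w ^ 2 := by rw [mul_pow, mul_comm]; gcongr
  have h5 : w * |a - b| = |w * a - w * b| := by rw [← mul_sub, abs_mul, abs_of_nonneg hw]
  rw [h5]
  unfold truncAvoid
  set A := ∫ z, avoidProb (ρ / ((j : ℝ) + 1)) (tailWeight ρ K j e) N z ∂(expMeasure 1)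
  have h6 : 1 - A - Real.exp (-(w * b))
      = -(A - w * a) + (-(w * a - w * b)) + (1 - w * b - Real.exp (-(w * b))) := by ring
  rw [h6]
  refine (abs_add_three _ _ _).trans ?_
  rw [abs_neg, abs_neg]
  linarith

theorem abs_exp_neg_sub_exp_neg_le {a b : ℝ} (ha : 0 ≤ a) (hb : 0 ≤ b) :
    |Real.exp (-a) - Real.exp (-b)| ≤ |a - b| := by
  wlog h : a ≤ b generalizing a b
  · rw [abs_sub_comm, abs_sub_comm a]; exact this hb ha (le_of_not_ge h)
  have h1 : Real.exp (-b) ≤ Real.exp (-a) := Real.exp_le_exp.2 (by linarith)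
  rw [abs_of_nonneg (by linarith), abs_sub_comm, abs_of_nonneg (by linarith)]
  have h2 : Real.exp (-b) = Real.exp (-a) * Real.exp (-(b - a)) := by
    rw [← Real.exp_add]; ring_nf
  have h3 := Real.add_one_le_exp (-(b - a))
  have h4 : Real.exp (-a) ≤ 1 := Real.exp_le_one_iff.2 (by linarith)
  have h5 := Real.exp_pos (-a)
  rw [h2]
  nlinarith

theorem one_sub_prod_le_sum {ι : Type*} (s : Finset ι) {q : ι → ℝ} (h0 : ∀ i, 0 ≤ q i)
    (h1 : ∀ i, q i ≤ 1) : 1 - ∏ i ∈ s, (1 - q i) ≤ ∑ i ∈ s, q i := by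
  classical
  induction s using Finset.induction_on with
  | empty => simp
  | insert a s ha ih =>
    rw [Finset.prod_insert ha, Finset.sum_insert ha]
    have : ∏ i ∈ s, (1 - q i) ≤ 1 :=
      Finset.prod_le_one (fun i _ => by linarith [h1 i]) fun i _ => by linarith [h0 i]
    nlinarith [h0 a]

theorem abs_prod_range_sub_prod_Ico_le {q : ℕ → ℝ} (h0 : ∀ i, 0 ≤ q i) (h1 : ∀ i, q i ≤ 1)
    (k m : ℕ) :
    |∏ i ∈ Finset.range m, (1 - q i) - ∏ i ∈ Finset.Ico k m, (1 - q i)|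
      ≤ ∑ i ∈ Finset.range k, q i := by
  have hle (s : Finset ℕ) : ∏ i ∈ s, (1 - q i) ≤ 1 :=
    Finset.prod_le_one (fun i _ => by linarith [h1 i]) fun i _ => by linarith [h0 i]
  have hge (s : Finset ℕ) : 0 ≤ ∏ i ∈ s, (1 - q i) :=
    Finset.prod_nonneg fun i _ => by linarith [h1 i]
  rcases le_total k m with h | h
  · rw [← Finset.prod_range_mul_prod_Ico _ h]
    set P := ∏ i ∈ Finset.Ico k m, (1 - q i)
    have hs := one_sub_prod_le_sum (Finset.range k) h0 h1
    have h2 := hle (Finset.range k)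
    have h3 : P ≤ 1 := hle _
    have h4 : 0 ≤ P := hge _
    rw [abs_sub_comm, abs_of_nonneg (by nlinarith)]
    nlinarith
  · rw [Finset.Ico_eq_empty_of_le h, Finset.prod_empty, abs_sub_comm,
      abs_of_nonneg (by linarith [hle (Finset.range m)])]
    refine (one_sub_prod_le_sum _ h0 h1).trans ?_
    exact Finset.sum_le_sum_of_subset_of_nonneg (Finset.range_subset_range.2 h) fun i _ _ => h0 i

theorem aemeasurable_of_tendsto_invWeight {Ω : Type*} [MeasurableSpace Ω]
    {μ : Measure Ω} {X : ℕ → Ω → ℝ} (hm : ∀ i, Measurable (X i)) {ρ : ℝ}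
    {V : Ω → ℝ}
    (hV : ∀ᵐ ω ∂μ, Tendsto (fun i => invWeight ρ i fun i => X i ω) atTop (𝓝 (V ω))) :
    AEMeasurable V μ := by
  have hXm : Measurable fun ω i => X i ω := measurable_pi_lambda _ hm
  exact aemeasurable_of_tendsto_metrizable_ae' (fun i =>
    ((measurable_invWeight ρ i).comp hXm).aemeasurable) hV

/-! ### Limit of the expected product at a fixed truncation level. -/

section Limit

variable {Ω : Type*} [MeasurableSpace Ω] {μ : Measure Ω} [IsProbabilityMeasure μ]

theorem integrable_of_measurable_of_abs_le {f : Ω → ℝ} (hf : Measurable f) {C : ℝ}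
    (h : ∀ ω, |f ω| ≤ C) : Integrable f μ :=
  Integrable.of_bound hf.aestronglyMeasurable C (ae_of_all _ h)

theorem measurable_truncAvoid_comp {X : ℕ → Ω → ℝ} (hm : ∀ i, Measurable (X i)) (ρ K : ℝ)
    (N i : ℕ) : Measurable fun ω => truncAvoid ρ K N i (fun i => X i ω) (X i ω) := by
  have hXm : Measurable fun ω i => X i ω := measurable_pi_lambda _ hm
  have h : Measurable fun ω => tailWeight ρ K i fun i => X i ω :=
    (measurable_tailWeight ρ K i).comp hXm
  have hi := hm i
  unfold truncAvoid avoidProb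
  fun_prop

theorem integrable_truncAvoid {X : ℕ → Ω → ℝ} (hm : ∀ i, Measurable (X i)) {ρ K : ℝ}
    (hρ : 0 < ρ) (hK : 1 ≤ K) (N i : ℕ) :
    Integrable (fun ω => truncAvoid ρ K N i (fun i => X i ω) (X i ω)) μ := by
  refine integrable_of_measurable_of_abs_le (measurable_truncAvoid_comp hm ρ K N i)
    (C := 1) fun ω => ?_
  rw [abs_of_nonneg (truncAvoid_nonneg hρ hK _ _ _ _)]
  exact truncAvoid_le_one hρ hK _ _ _ _

theorem integrable_prod_truncAvoid {X : ℕ → Ω → ℝ} (hm : ∀ i, Measurable (X i)) {ρ K : ℝ}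
    (hρ : 0 < ρ) (hK : 1 ≤ K) (N : ℕ) (s : Finset ℕ) :
    Integrable (fun ω => ∏ i ∈ s, (1 - truncAvoid ρ K N i (fun i => X i ω) (X i ω))) μ := by
  refine integrable_of_measurable_of_abs_le (C := 1) (Finset.measurable_fun_prod _ fun j _ =>
    measurable_const.sub (measurable_truncAvoid_comp hm ρ K N j)) fun ω =>
    abs_finset_prod_le_one _ fun j => ?_
  rw [abs_le]
  constructor <;> linarith [truncAvoid_nonneg hρ hK N j (fun i => X i ω) (X j ω),
    truncAvoid_le_one hρ hK N j (fun i => X i ω) (X j ω)]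

/-- Union bound for the bins before `k`, where freezing the weight at index `k` is not possible. -/
theorem abs_integral_prod_range_sub_le {X : ℕ → Ω → ℝ} (hm : ∀ i, Measurable (X i)) {ρ K : ℝ}
    (hρ : 0 < ρ) (hK : 1 ≤ K) (N k m : ℕ) :
    |∫ ω, ∏ i ∈ Finset.range m, (1 - truncAvoid ρ K N i (fun i => X i ω) (X i ω)) ∂μ
      - ∫ ω, ∏ i ∈ Finset.Ico k m, (1 - truncAvoid ρ K N i (fun i => X i ω) (X i ω)) ∂μ|
      ≤ ∑ i ∈ Finset.range k, ∫ ω, truncAvoid ρ K N i (fun i => X i ω) (X i ω) ∂μ := by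
  have h1 := integrable_prod_truncAvoid (μ := μ) hm hρ hK N
  have hqi := integrable_truncAvoid (μ := μ) hm hρ hK N
  rw [← integral_sub (h1 _) (h1 _), ← integral_finsetSum _ fun i _ => hqi i]
  refine abs_integral_le_integral_abs.trans ?_
  refine integral_mono ((h1 _).sub (h1 _)).abs (integrable_finsetSum _ fun i _ => hqi i)
    fun ω => ?_
  exact abs_prod_range_sub_prod_Ico_le (fun i => truncAvoid_nonneg hρ hK _ _ _ _)
    (fun i => truncAvoid_le_one hρ hK _ _ _ _) _ _

theorem abs_min_invWeight_le {ρ K : ℝ} (hK : 1 ≤ K) (i : ℕ) (e : ℕ → ℝ) :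
    |min (invWeight ρ i e) K| ≤ K := by
  rw [abs_of_nonneg (le_min (invWeight_pos _ _ _).le (by linarith))]
  exact min_le_right _ _

/-- The replacement principle with `r j = exp (-w_j ξ_k)`, where `ξ_k` is the capped weight at index
`k`; the product of the `r j` collapses into one exponential. -/
theorem abs_integral_prod_Ico_sub_le {X : ℕ → Ω → ℝ} (hX : iIndepFun X μ)
    (hm : ∀ i, Measurable (X i)) (hlaw : ∀ i, μ.map (X i) = expMeasure 1) {ρ K : ℝ} (hρ : 0 < ρ)
    (hK : 1 ≤ K) {N : ℕ} (hN : 0 < N) {k : ℕ} (hk : ρ ≤ (k : ℝ) + 1) (m : ℕ) :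
    |∫ ω, ∏ j ∈ Finset.Ico k m, (1 - truncAvoid ρ K N j (fun i => X i ω) (X j ω)) ∂μ
      - ∫ ω, Real.exp (-((∑ j ∈ Finset.Ico k m, binWeight ρ N j)
          * min (invWeight ρ k fun i => X i ω) K)) ∂μ|
      ≤ ∑ j ∈ Finset.Ico k m, (2 * K ^ 2 * binWeight ρ N j ^ 2 + binWeight ρ N j *
          ∫ ω, |min (invWeight ρ j fun i => X i ω) K - min (invWeight ρ k fun i => X i ω) K| ∂μ) := by
  rcases le_total m k with hkm | hkm
  · simp [Finset.Ico_eq_empty_of_le hkm]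
  have hXm : Measurable fun ω i => X i ω := measurable_pi_lambda _ hm
  have hξ (j : ℕ) : Measurable fun e => min (invWeight ρ j e) K :=
    (measurable_invWeight ρ j).min measurable_const
  have hξ0 (j : ℕ) (e) : 0 ≤ min (invWeight ρ j e) K :=
    le_min (invWeight_pos _ _ _).le (by linarith)
  have h := abs_integral_prod_sub_prod_le hX hm hlaw (Q := truncAvoid ρ K N)
    (measurable_truncAvoid ρ K N) (truncAvoid_nonneg hρ hK N) (truncAvoid_le_one hρ hK N)
    (fun j e e' h => by
      funext z; unfold truncAvoid; rw [dependsOnFirst_tailWeight ρ K j e e' h])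
    (k := k) (r := fun j e => Real.exp (-(binWeight ρ N j * min (invWeight ρ k e) K)))
    (fun j => by have := hξ k; fun_prop)
    (fun j e => by
      rw [abs_of_pos (Real.exp_pos _)]
      exact Real.exp_le_one_iff.2 (neg_nonpos.2 (mul_nonneg (binWeight_nonneg hρ N j) (hξ0 k e))))
    (fun j e e' h => by beta_reduce; rw [dependsOnFirst_invWeight ρ k e e' h])
    hkm (fun _ => 1) measurable_const (by simp) (fun _ _ _ => rfl)
  simp only [one_mul, ← Real.exp_sum, Finset.sum_neg_distrib, ← Finset.sum_mul] at h
  have hS : 0 ≤ ∑ j ∈ Finset.Ico k m, binWeight ρ N j :=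
    Finset.sum_nonneg fun j _ => binWeight_nonneg hρ N j
  rw [integral_sub] at h
  · refine h.trans (Finset.sum_le_sum fun j hj => ?_)
    have hj' : ρ ≤ (j : ℝ) + 1 := by
      have : (k : ℝ) ≤ j := by exact_mod_cast (Finset.mem_Ico.1 hj).1
      linarith
    have hdi : Integrable (fun ω => |min (invWeight ρ j fun i => X i ω) K
        - min (invWeight ρ k fun i => X i ω) K|) μ := by
      refine integrable_of_measurable_of_abs_le (C := 2 * K)
        (((hξ j).comp hXm).sub ((hξ k).comp hXm)).abs fun ω => ?_
      rw [abs_abs]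
      refine (abs_sub _ _).trans ?_
      linarith [abs_min_invWeight_le (ρ := ρ) hK j fun i => X i ω,
        abs_min_invWeight_le (ρ := ρ) hK k fun i => X i ω]
    calc _ ≤ ∫ ω, (2 * K ^ 2 * binWeight ρ N j ^ 2 + binWeight ρ N j *
            |min (invWeight ρ j fun i => X i ω) K - min (invWeight ρ k fun i => X i ω) K|) ∂μ :=
          integral_mono_of_nonneg (ae_of_all _ fun ω => abs_nonneg _)
            ((integrable_const _).add (hdi.const_mul _))
            (ae_of_all _ fun ω => abs_bias_le hρ hK hN hj' _)
      _ = _ := by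
          rw [integral_add (integrable_const _) (hdi.const_mul _)]
          simp [integral_const_mul]
  · exact integrable_prod_truncAvoid hm hρ hK N _
  · refine integrable_of_measurable_of_abs_le (C := 1) ?_ fun ω => ?_
    · have := (hξ k).comp hXm
      exact ((this.const_mul _).neg).exp
    · rw [abs_of_pos (Real.exp_pos _)]
      exact Real.exp_le_one_iff.2 (neg_nonpos.2 (mul_nonneg hS (hξ0 k _)))

/-- The expected truncated avoidance probability of a fixed bin tends to zero. -/
theorem tendsto_integral_truncAvoid {X : ℕ → Ω → ℝ}
    (hm : ∀ i, Measurable (X i)) (hlaw : ∀ i, μ.map (X i) = expMeasure 1) {ρ K : ℝ} (hρ : 0 < ρ)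
    (hK : 1 ≤ K) {N : ℕ → ℕ} (hN : Tendsto N atTop atTop) (i : ℕ) :
    Tendsto (fun n => ∫ ω, truncAvoid ρ K (N n) i (fun i => X i ω) (X i ω) ∂μ) atTop (𝓝 0) := by
  have hXm : Measurable fun ω i => X i ω := measurable_pi_lambda _ hm
  have hpos : ∀ᵐ ω ∂μ, 0 < X i ω := by
    have := ae_pos_expMeasure one_pos
    rw [← hlaw i] at this
    exact ae_of_ae_map (hm i).aemeasurable this
  have := tendsto_integral_of_dominated_convergence (μ := μ)
    (F := fun n ω => truncAvoid ρ K (N n) i (fun i => X i ω) (X i ω)) (f := fun _ => 0)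
    (fun _ => (1 : ℝ))
    (fun n => (measurable_truncAvoid_comp hm ρ K (N n) i).aestronglyMeasurable)
    (integrable_const _)
    (fun n => ae_of_all _ fun ω => by
      rw [Real.norm_of_nonneg (truncAvoid_nonneg hρ hK _ _ _ _)]
      exact truncAvoid_le_one hρ hK _ _ _ _)
    (by
      filter_upwards [hpos] with ω hω
      have hl : 0 < ρ / ((i : ℝ) + 1) := by positivity
      have hs := tailWeight_pos ρ K i fun i => X i ω
      refine (tendsto_pow_atTop_nhds_zero_of_lt_one
        (avoidBase_mem hl.le hs.le (tailWeight_le_one hρ hK i _) (X i ω)).1 ?_).comp hN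
      have : Real.exp (-(ρ / ((i : ℝ) + 1) * |X i ω|)) < 1 :=
        by
        rw [Real.exp_lt_one_iff]; exact neg_neg_of_pos (mul_pos hl (abs_pos.2 hω.ne'))
      nlinarith)
  simpa using this

theorem tendsto_integral_abs_sub {X : ℕ → Ω → ℝ} (hm : ∀ i, Measurable (X i)) {ρ K : ℝ}
    (hK : 1 ≤ K) {V : Ω → ℝ}
    (hV : ∀ᵐ ω ∂μ, Tendsto (fun i => invWeight ρ i fun i => X i ω) atTop (𝓝 (V ω))) :
    Tendsto (fun j => ∫ ω, |min (invWeight ρ j fun i => X i ω) K - min (V ω) K| ∂μ)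
      atTop (𝓝 0) := by
  have hXm : Measurable fun ω i => X i ω := measurable_pi_lambda _ hm
  have hVm := aemeasurable_of_tendsto_invWeight hm hV
  have := tendsto_integral_of_dominated_convergence (μ := μ)
    (F := fun j ω => |min (invWeight ρ j fun i => X i ω) K - min (V ω) K|) (f := fun _ => 0)
    (fun _ => 2 * K)
    (fun j => by
      have h1 : Measurable fun ω => min (invWeight ρ j fun i => X i ω) K :=
        ((measurable_invWeight ρ j).comp hXm).min measurable_const
      exact ((h1.aemeasurable.sub (hVm.min aemeasurable_const)).norm).aestronglyMeasurable)
    (integrable_const _)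
    (fun j => by
      filter_upwards [hV] with ω hω
      have hV0 : 0 ≤ V ω := ge_of_tendsto' hω fun i => (invWeight_pos _ _ _).le
      rw [Real.norm_eq_abs, abs_abs]
      refine (abs_sub _ _).trans ?_
      have h1 := abs_min_invWeight_le (ρ := ρ) hK j fun i => X i ω
      have h2 : |min (V ω) K| ≤ K := by
        rw [abs_of_nonneg (le_min hV0 (by linarith))]; exact min_le_right _ _
      linarith)
    (by
      filter_upwards [hV] with ω hω
      have := ((hω.min (tendsto_const_nhds (x := K))).sub_const (min (V ω) K)).abs
      simpa using this)
  simpa using this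

/-- For fixed `k`, the first `k` bins are asymptotically always hit and carry negligible weight.
Beyond `k` the capped weights are `L¹`-close to their limit, hence to the one at `k`. The number of
balls tends to infinity before `k` does. -/
theorem tendsto_integral_prod_truncAvoid {X : ℕ → Ω → ℝ} (hX : iIndepFun X μ)
    (hm : ∀ i, Measurable (X i)) (hlaw : ∀ i, μ.map (X i) = expMeasure 1) {ρ K : ℝ} (hρ : 0 < ρ)
    (hK : 1 ≤ K) {V : Ω → ℝ}
    (hV : ∀ᵐ ω ∂μ, Tendsto (fun i => invWeight ρ i fun i => X i ω) atTop (𝓝 (V ω)))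
    {N m : ℕ → ℕ} (hN : Tendsto N atTop atTop) {c : ℝ}
    (hc : Tendsto (fun n => ∑ i ∈ Finset.range (m n), binWeight ρ (N n) i) atTop (𝓝 c))
    (hmax : Tendsto (fun n => (m n : ℝ) ^ (ρ + 1) / N n) atTop (𝓝 0)) :
    Tendsto (fun n => ∫ ω, ∏ i ∈ Finset.range (m n),
        (1 - truncAvoid ρ K (N n) i (fun i => X i ω) (X i ω)) ∂μ) atTop
      (𝓝 (∫ ω, Real.exp (-(c * min (V ω) K)) ∂μ)) := by
  have hXm : Measurable fun ω i => X i ω := measurable_pi_lambda _ hm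
  have hVm := aemeasurable_of_tendsto_invWeight hm hV
  have hc0 : 0 ≤ c := ge_of_tendsto' hc fun n =>
    Finset.sum_nonneg fun i _ => binWeight_nonneg hρ _ i
  have hV0 : ∀ᵐ ω ∂μ, 0 ≤ V ω := by
    filter_upwards [hV] with ω hω
    exact ge_of_tendsto' hω fun i => (invWeight_pos _ _ _).le
  have hw0 (i : ℕ) : Tendsto (fun n => binWeight ρ (N n) i) atTop (𝓝 0) := by
    unfold binWeight
    exact tendsto_const_nhds.div_atTop
      ((tendsto_natCast_atTop_atTop.comp hN).const_mul_atTop hρ)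
  set d : ℕ → ℝ := fun j => ∫ ω, |min (invWeight ρ j fun i => X i ω) K - min (V ω) K| ∂μ with hd
  have hdlim : Tendsto d atTop (𝓝 0) := tendsto_integral_abs_sub hm hK hV
  have hξm (j : ℕ) : Measurable fun ω => min (invWeight ρ j fun i => X i ω) K :=
    ((measurable_invWeight ρ j).comp hXm).min measurable_const
  have hdint (j : ℕ) : Integrable
      (fun ω => |min (invWeight ρ j fun i => X i ω) K - min (V ω) K|) μ := by
    refine Integrable.of_bound (C := 2 * K) ((((hξm j).aemeasurable.sub
      (hVm.min aemeasurable_const)).norm).aestronglyMeasurable) ?_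
    filter_upwards [hV0] with ω hω
    rw [Real.norm_eq_abs, abs_abs]
    refine (abs_sub _ _).trans ?_
    have h1 := abs_min_invWeight_le (ρ := ρ) hK j fun i => X i ω
    have h2 : |min (V ω) K| ≤ K := by
      rw [abs_of_nonneg (le_min hω (by linarith))]; exact min_le_right _ _
    linarith
  have hdd (j k : ℕ) : ∫ ω, |min (invWeight ρ j fun i => X i ω) K
      - min (invWeight ρ k fun i => X i ω) K| ∂μ ≤ d j + d k := by
    rw [hd, ← integral_add (hdint j) (hdint k)]
    refine integral_mono (integrable_of_measurable_of_abs_le (C := 2 * K)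
      ((hξm j).sub (hξm k)).abs fun ω => ?_) ((hdint j).add (hdint k)) fun ω => ?_
    · rw [abs_abs]
      refine (abs_sub _ _).trans ?_
      linarith [abs_min_invWeight_le (ρ := ρ) hK j fun i => X i ω,
        abs_min_invWeight_le (ρ := ρ) hK k fun i => X i ω]
    · rw [abs_sub_comm (min (invWeight ρ k fun i => X i ω) K)]
      exact abs_sub_le _ _ _
  rw [Metric.tendsto_nhds]
  intro ε hε
  -- The final error tends to `3 c δ`: `2 c δ` from the biases and `c δ` from replacing the frozen
  -- weight by `V`.
  set δ := ε / (3 * c + 1) with hδ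
  have hδ0 : 0 < δ := by positivity
  have hδε : 3 * c * δ < ε := by
    rw [hδ, mul_div_assoc', div_lt_iff₀ (by positivity)]; nlinarith
  obtain ⟨k, hkρ, hkd⟩ : ∃ k : ℕ, ρ ≤ (k : ℝ) + 1 ∧ ∀ j ≥ k, d j ≤ δ := by
    obtain ⟨k1, hk1⟩ := exists_nat_ge ρ
    obtain ⟨k2, hk2⟩ := eventually_atTop.1 (hdlim.eventually (ge_mem_nhds hδ0))
    refine ⟨max k1 k2, ?_, fun j hj => hk2 j (le_trans (le_max_right _ _) hj)⟩
    have : (k1 : ℝ) ≤ (max k1 k2 : ℕ) := by exact_mod_cast le_max_left _ _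
    linarith
  set T : ℕ → ℝ := fun n => ∑ i ∈ Finset.range (m n), binWeight ρ (N n) i with hT
  set q : ℕ → ℝ := fun n => ∑ i ∈ Finset.range k,
    ∫ ω, truncAvoid ρ K (N n) i (fun i => X i ω) (X i ω) ∂μ with hq
  set t : ℕ → ℝ := fun n => ∑ i ∈ Finset.range k, binWeight ρ (N n) i with ht
  have hqlim : Tendsto q atTop (𝓝 0) := by
    have := tendsto_finsetSum (Finset.range k) fun i _ =>
      tendsto_integral_truncAvoid hm hlaw hρ hK hN i
    simpa using this
  have htlim : Tendsto t atTop (𝓝 0) := by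
    have := tendsto_finsetSum (Finset.range k) fun i _ => hw0 i
    simpa using this
  -- In order: the first `k` bins, the replacement of factors (with the largest weight bounding one
  -- factor of each square), and the passage from `S` and the frozen weight to `c` and `V`.
  let b : ℕ → ℝ := fun n => q n + (2 * K ^ 2 * ((m n : ℝ) ^ (ρ + 1) / N n / ρ) + 2 * δ) * T n
    + (K * (|T n - c| + t n) + c * δ)
  have hblim : Tendsto b atTop (𝓝 (0 + (2 * K ^ 2 * (0 / ρ) + 2 * δ) * c
      + (K * (|c - c| + 0) + c * δ))) :=
    (hqlim.add ((((hmax.div_const ρ).const_mul (2 * K ^ 2)).add_const (2 * δ)).mul hc)).add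
      ((((hc.sub_const c).abs.add htlim).const_mul K).add_const (c * δ))
  have hb : ∀ᶠ n in atTop, b n < ε := by
    refine hblim.eventually (gt_mem_nhds ?_)
    simp only [sub_self, abs_zero, zero_div, mul_zero, zero_add, add_zero]
    linarith
  filter_upwards [hb, hN.eventually_gt_atTop 0] with n hbn hNn
  refine lt_of_le_of_lt ?_ hbn
  rw [Real.dist_eq]
  set S := ∑ j ∈ Finset.Ico k (m n), binWeight ρ (N n) j with hS
  have hS0 : 0 ≤ S := Finset.sum_nonneg fun j _ => binWeight_nonneg hρ _ j
  have hST : S ≤ T n := by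
    refine Finset.sum_le_sum_of_subset_of_nonneg (fun i hi => ?_) fun i _ _ =>
      binWeight_nonneg hρ _ i
    exact Finset.mem_range.2 (Finset.mem_Ico.1 hi).2
  have hTS : T n ≤ S + t n := by
    rw [hS, ht, hT]
    dsimp only
    rcases le_total k (m n) with h | h
    · rw [← Finset.sum_range_add_sum_Ico _ h, add_comm]
    · rw [Finset.Ico_eq_empty_of_le h, Finset.sum_empty, zero_add]
      exact Finset.sum_le_sum_of_subset_of_nonneg (Finset.range_subset_range.2 h) fun i _ _ =>
        binWeight_nonneg hρ _ i
  have hA : |∫ ω, ∏ i ∈ Finset.range (m n),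
        (1 - truncAvoid ρ K (N n) i (fun i => X i ω) (X i ω)) ∂μ
      - ∫ ω, ∏ i ∈ Finset.Ico k (m n),
        (1 - truncAvoid ρ K (N n) i (fun i => X i ω) (X i ω)) ∂μ| ≤ q n :=
    abs_integral_prod_range_sub_le hm hρ hK (N n) k (m n)
  have hB := abs_integral_prod_Ico_sub_le hX hm hlaw hρ hK hNn hkρ (m n)
  have hB' : ∑ j ∈ Finset.Ico k (m n), (2 * K ^ 2 * binWeight ρ (N n) j ^ 2 + binWeight ρ (N n) j *
      ∫ ω, |min (invWeight ρ j fun i => X i ω) K - min (invWeight ρ k fun i => X i ω) K| ∂μ)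
      ≤ (2 * K ^ 2 * ((m n : ℝ) ^ (ρ + 1) / N n / ρ) + 2 * δ) * T n := by
    have hcoef : 0 ≤ 2 * K ^ 2 * ((m n : ℝ) ^ (ρ + 1) / N n / ρ) + 2 * δ := by positivity
    refine le_trans ?_ (mul_le_mul_of_nonneg_left hST hcoef)
    rw [hS, Finset.mul_sum]
    refine Finset.sum_le_sum fun j hj => ?_
    have hw := binWeight_nonneg hρ (N n) j
    have hj := Finset.mem_Ico.1 hj
    have h1 : binWeight ρ (N n) j ≤ (m n : ℝ) ^ (ρ + 1) / N n / ρ := by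
      rw [div_div, mul_comm (N n : ℝ), binWeight]
      have : (j : ℝ) + 1 ≤ m n := by exact_mod_cast hj.2
      gcongr
    have h2 := (hdd j k).trans (add_le_add (hkd j hj.1) (hkd k le_rfl))
    have h3 := mul_le_mul_of_nonneg_left h2 hw
    have h4 := mul_le_mul_of_nonneg_left h1 (show 0 ≤ 2 * K ^ 2 * binWeight ρ (N n) j by positivity)
    nlinarith [h3, h4]
  have hD : |∫ ω, Real.exp (-(S * min (invWeight ρ k fun i => X i ω) K)) ∂μ
      - ∫ ω, Real.exp (-(c * min (V ω) K)) ∂μ| ≤ K * (|T n - c| + t n) + c * δ := by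
    have hi1 : Integrable (fun ω => Real.exp (-(S * min (invWeight ρ k fun i => X i ω) K))) μ := by
      refine integrable_of_measurable_of_abs_le (C := 1) (((hξm k).const_mul _).neg.exp) fun ω => ?_
      rw [abs_of_pos (Real.exp_pos _)]
      exact Real.exp_le_one_iff.2 (neg_nonpos.2 (mul_nonneg hS0
        (le_min (invWeight_pos _ _ _).le (by linarith))))
    have hi2 : Integrable (fun ω => Real.exp (-(c * min (V ω) K))) μ := by
      refine Integrable.of_bound (C := 1)
        (Real.measurable_exp.comp_aemeasurable
          ((hVm.min aemeasurable_const).const_mul c).neg).aestronglyMeasurable ?_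
      filter_upwards [hV0] with ω hω
      rw [Real.norm_of_nonneg (Real.exp_pos _).le]
      exact Real.exp_le_one_iff.2 (neg_nonpos.2 (mul_nonneg hc0 (le_min hω (by linarith))))
    rw [← integral_sub hi1 hi2]
    refine abs_integral_le_integral_abs.trans ?_
    have hSc : |S - c| ≤ |T n - c| + t n := by
      have : |S - T n| ≤ t n := by rw [abs_le]; constructor <;> linarith
      calc |S - c| ≤ |S - T n| + |T n - c| := abs_sub_le _ _ _
        _ ≤ _ := by linarith
    have hint2 : Integrable (fun ω => K * (|T n - c| + t n)
        + c * |min (invWeight ρ k fun i => X i ω) K - min (V ω) K|) μ :=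
      (integrable_const _).add ((hdint k).const_mul c)
    calc _ ≤ ∫ ω, (K * (|T n - c| + t n)
            + c * |min (invWeight ρ k fun i => X i ω) K - min (V ω) K|) ∂μ := by
          refine integral_mono_ae (hi1.sub hi2).abs hint2 ?_
          filter_upwards [hV0] with ω hω
          set a := min (invWeight ρ k fun i => X i ω) K
          set b := min (V ω) K
          have ha0 : 0 ≤ a := le_min (invWeight_pos _ _ _).le (by linarith)
          have haK : a ≤ K := min_le_right _ _
          have hb0 : 0 ≤ b := le_min hω (by linarith)
          refine (abs_exp_neg_sub_exp_neg_le (mul_nonneg hS0 ha0) (mul_nonneg hc0 hb0)).trans ?_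
          rw [show S * a - c * b = a * (S - c) + c * (a - b) by ring]
          refine (abs_add_le _ _).trans ?_
          rw [abs_mul, abs_mul, abs_of_nonneg ha0, abs_of_nonneg hc0]
          gcongr
      _ = K * (|T n - c| + t n) + c * d k := by
          rw [integral_add (integrable_const _) ((hdint k).const_mul c)]
          simp [hd, integral_const_mul]
      _ ≤ _ := by
          have := mul_le_mul_of_nonneg_left (hkd k le_rfl) hc0
          linarith
  have htri : ∀ a b c d : ℝ, |a - d| ≤ |a - b| + |b - c| + |c - d| := fun a b c d =>
    (abs_sub_le a c d).trans (by linarith [abs_sub_le a b c])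
  refine (htri _ (∫ ω, ∏ i ∈ Finset.Ico k (m n),
        (1 - truncAvoid ρ K (N n) i (fun i => X i ω) (X i ω)) ∂μ)
    (∫ ω, Real.exp (-(S * min (invWeight ρ k fun i => X i ω) K)) ∂μ) _).trans ?_
  exact add_le_add (add_le_add hA (hB.trans hB')) hD

end Limit

/-! ### Removing the truncation. -/

/-- The probability that a ball falls into the bin `(t_i, t_{i+1}]`. -/
noncomputable def binProb (ρ : ℝ) (e : ℕ → ℝ) (i : ℕ) : ℝ :=
  Real.exp (-(ρ * splitSum e i)) - Real.exp (-(ρ * splitSum e (i + 1)))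

theorem splitSum_mono (e : ℕ → ℝ) : Monotone (splitSum e) :=
  monotone_nat_of_le_succ fun n => by
    rw [splitSum, splitSum, Finset.sum_range_succ]
    have : 0 ≤ |e n| / ((n : ℝ) + 1) := by positivity
    linarith

theorem binProb_nonneg {ρ : ℝ} (hρ : 0 < ρ) (e : ℕ → ℝ) (i : ℕ) : 0 ≤ binProb ρ e i := by
  refine sub_nonneg.2 (Real.exp_le_exp.2 (neg_le_neg ?_))
  exact mul_le_mul_of_nonneg_left (splitSum_mono e (Nat.le_succ i)) hρ.le

theorem binProb_le_one {ρ : ℝ} (hρ : 0 < ρ) (e : ℕ → ℝ) (i : ℕ) : binProb ρ e i ≤ 1 := by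
  have h1 : Real.exp (-(ρ * splitSum e i)) ≤ 1 :=
    Real.exp_le_one_iff.2 (neg_nonpos.2 (mul_nonneg hρ.le (splitSum_nonneg e i)))
  have h2 := Real.exp_pos (-(ρ * splitSum e (i + 1)))
  unfold binProb; linarith

theorem measurable_binProb (ρ : ℝ) (i : ℕ) : Measurable fun e => binProb ρ e i := by
  have h1 := measurable_splitSum i
  have h2 := measurable_splitSum (i + 1)
  unfold binProb; fun_prop

theorem truncAvoid_eq_of_le {ρ K : ℝ} (hK : 1 ≤ K) {i : ℕ} {e : ℕ → ℝ}
    (h : invWeight ρ i e ≤ K) (N : ℕ) :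
    truncAvoid ρ K N i e (e i) = (1 - binProb ρ e i) ^ N := by
  rw [truncAvoid, avoidProb, tailWeight_of_le hK h, binProb, mul_sub, mul_one, ← Real.exp_add,
    splitSum, splitSum, Finset.sum_range_succ]
  congr 4
  ring_nf

section Limit

variable {Ω : Type*} [MeasurableSpace Ω] {μ : Measure Ω} [IsProbabilityMeasure μ]

theorem integrable_prod_binProb {X : ℕ → Ω → ℝ} (hm : ∀ i, Measurable (X i)) {ρ : ℝ}
    (hρ : 0 < ρ) (N m : ℕ) :
    Integrable (fun ω => ∏ i ∈ Finset.range m, (1 - (1 - binProb ρ (fun i => X i ω) i) ^ N)) μ := by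
  have hXm : Measurable fun ω i => X i ω := measurable_pi_lambda _ hm
  refine integrable_of_measurable_of_abs_le (C := 1) (Finset.measurable_fun_prod _ fun j _ => ?_)
    fun ω => abs_finset_prod_le_one _ fun j => ?_
  · have : Measurable fun ω => binProb ρ (fun i => X i ω) j := (measurable_binProb ρ j).comp hXm
    fun_prop
  · have h0 := binProb_nonneg hρ (fun i => X i ω) j
    have h1 := binProb_le_one hρ (fun i => X i ω) j
    have h2 : (1 - binProb ρ (fun i => X i ω) j) ^ N ≤ 1 :=
      pow_le_one₀ (by linarith) (by linarith)
    have h3 : 0 ≤ (1 - binProb ρ (fun i => X i ω) j) ^ N := pow_nonneg (by linarith) N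
    rw [abs_le]
    constructor <;> linarith

theorem abs_integral_sub_le_measureReal {f g : Ω → ℝ} (hf : Integrable f μ) (hg : Integrable g μ)
    {S : Set Ω} (hS : MeasurableSet S) (hf1 : ∀ᵐ ω ∂μ, f ω ∈ Set.Icc (0 : ℝ) 1)
    (hg1 : ∀ᵐ ω ∂μ, g ω ∈ Set.Icc (0 : ℝ) 1) (hfg : ∀ᵐ ω ∂μ, ω ∉ S → f ω = g ω) :
    |∫ ω, f ω ∂μ - ∫ ω, g ω ∂μ| ≤ μ.real S := by
  rw [← integral_sub hf hg]
  refine abs_integral_le_integral_abs.trans ?_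
  have h1 : ∫ ω, S.indicator (fun _ => (1 : ℝ)) ω ∂μ = μ.real S := by
    rw [integral_indicator hS]; simp
  rw [← h1]
  refine integral_mono_ae (hf.sub hg).abs ((integrable_const 1).indicator hS) ?_
  filter_upwards [hf1, hg1, hfg] with ω a b c
  by_cases h : ω ∈ S
  · rw [Set.indicator_of_mem h, abs_le]
    constructor <;> linarith [a.1, a.2, b.1, b.2]
  · rw [Set.indicator_of_notMem h, c h]; simp

/-- Outside the event `bad K` that some weight exceeds `K`, truncation changes neither the product
nor the limit. All quantities lie in `[0, 1]`, so each of the two comparisons costs at most the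
probability of `bad K`. -/
theorem tendsto_integral_prod_binProb {X : ℕ → Ω → ℝ} (hX : iIndepFun X μ)
    (hm : ∀ i, Measurable (X i)) (hlaw : ∀ i, μ.map (X i) = expMeasure 1) {ρ : ℝ} (hρ : 0 < ρ)
    {V : Ω → ℝ}
    (hV : ∀ᵐ ω ∂μ, Tendsto (fun i => invWeight ρ i fun i => X i ω) atTop (𝓝 (V ω)))
    {N m : ℕ → ℕ} (hN : Tendsto N atTop atTop) {c : ℝ}
    (hc : Tendsto (fun n => ∑ i ∈ Finset.range (m n), binWeight ρ (N n) i) atTop (𝓝 c))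
    (hmax : Tendsto (fun n => (m n : ℝ) ^ (ρ + 1) / N n) atTop (𝓝 0)) :
    Tendsto (fun n => ∫ ω, ∏ i ∈ Finset.range (m n),
        (1 - (1 - binProb ρ (fun i => X i ω) i) ^ (N n)) ∂μ) atTop
      (𝓝 (∫ ω, Real.exp (-(c * V ω)) ∂μ)) := by
  have hXm : Measurable fun ω i => X i ω := measurable_pi_lambda _ hm
  have hVm := aemeasurable_of_tendsto_invWeight hm hV
  have hc0 : 0 ≤ c := ge_of_tendsto' hc fun n =>
    Finset.sum_nonneg fun i _ => binWeight_nonneg hρ _ i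
  have hV0 : ∀ᵐ ω ∂μ, 0 ≤ V ω := by
    filter_upwards [hV] with ω hω
    exact ge_of_tendsto' hω fun i => (invWeight_pos _ _ _).le
  let bad : ℕ → Set Ω := fun K => ⋃ i, {ω | (K : ℝ) < invWeight ρ i fun i => X i ω}
  have hbadm (K : ℕ) : MeasurableSet (bad K) := MeasurableSet.iUnion fun i =>
    measurableSet_lt measurable_const ((measurable_invWeight ρ i).comp hXm)
  have hbad : Tendsto (fun K => μ.real (bad K)) atTop (𝓝 0) := by
    have hanti : Antitone bad := fun K L hKL => Set.iUnion_mono fun i ω (hω : (L : ℝ) < _) =>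
      lt_of_le_of_lt (by exact_mod_cast hKL) hω
    have h := tendsto_measure_iInter_atTop (μ := μ) (fun K => (hbadm K).nullMeasurableSet) hanti
      ⟨0, measure_ne_top _ _⟩
    -- On the intersection the weights are unbounded, hence do not converge.
    have h0 : μ (⋂ K, bad K) = 0 := by
      refine measure_mono_null (fun ω hω => ?_) (ae_iff.1 hV)
      intro (hlim : Tendsto (fun i => invWeight ρ i fun i => X i ω) atTop (𝓝 (V ω)))
      obtain ⟨C, hC⟩ := hlim.bddAbove_range
      obtain ⟨K, hK⟩ := exists_nat_ge C
      obtain ⟨i, hi⟩ := Set.mem_iUnion.1 (Set.mem_iInter.1 hω K)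
      have h1 : (K : ℝ) < invWeight ρ i fun i => X i ω := hi
      have h2 := hC ⟨i, rfl⟩
      dsimp only at h2
      linarith
    rw [h0] at h
    exact (ENNReal.tendsto_toReal ENNReal.zero_ne_top).comp h
  rw [Metric.tendsto_nhds]
  intro ε hε
  obtain ⟨K, hK1, hKε⟩ : ∃ K : ℕ, 1 ≤ K ∧ μ.real (bad K) < ε / 3 :=
    ((eventually_ge_atTop 1).and (hbad.eventually (gt_mem_nhds (by positivity)))).exists
  have hK1' : (1 : ℝ) ≤ K := by exact_mod_cast hK1
  have hmain := tendsto_integral_prod_truncAvoid hX hm hlaw hρ hK1' hV hN hc hmax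
  have hgood {ω : Ω} (hω : ω ∉ bad K) (i : ℕ) : (invWeight ρ i fun i => X i ω) ≤ K := by
    by_contra h
    exact hω (Set.mem_iUnion.2 ⟨i, not_le.1 h⟩)
  filter_upwards [Metric.tendsto_nhds.1 hmain (ε / 3) (by positivity)] with n hn
  rw [Real.dist_eq] at hn ⊢
  have h1 := abs_integral_sub_le_measureReal (μ := μ)
    (integrable_prod_binProb hm hρ (N n) (m n))
    (integrable_prod_truncAvoid hm hρ hK1' (N n) (Finset.range (m n))) (hbadm K)
    (ae_of_all _ fun ω => by
      have h (i : ℕ) : (1 - binProb ρ (fun i => X i ω) i) ^ (N n) ∈ Set.Icc (0 : ℝ) 1 := by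
        have h0 := binProb_nonneg hρ (fun i => X i ω) i
        have h1 := binProb_le_one hρ (fun i => X i ω) i
        exact ⟨pow_nonneg (by linarith) _, pow_le_one₀ (by linarith) (by linarith)⟩
      exact ⟨Finset.prod_nonneg fun i _ => by linarith [(h i).2],
        Finset.prod_le_one (fun i _ => by linarith [(h i).2]) fun i _ => by linarith [(h i).1]⟩)
    (ae_of_all _ fun ω => by
      have h0 := fun i => truncAvoid_nonneg hρ hK1' (N n) i (fun i => X i ω) (X i ω)
      have h1 := fun i => truncAvoid_le_one hρ hK1' (N n) i (fun i => X i ω) (X i ω)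
      exact ⟨Finset.prod_nonneg fun i _ => by linarith [h1 i],
        Finset.prod_le_one (fun i _ => by linarith [h1 i]) fun i _ => by linarith [h0 i]⟩)
    (ae_of_all _ fun ω hω => Finset.prod_congr rfl fun i _ => by
      rw [truncAvoid_eq_of_le (e := fun i => X i ω) hK1' (hgood hω i)])
  have hexp {a : ℝ} (ha : 0 ≤ a) : Real.exp (-(c * a)) ∈ Set.Icc (0 : ℝ) 1 :=
    ⟨(Real.exp_pos _).le, Real.exp_le_one_iff.2 (neg_nonpos.2 (mul_nonneg hc0 ha))⟩
  have hI1 : ∀ᵐ ω ∂μ, Real.exp (-(c * min (V ω) K)) ∈ Set.Icc (0 : ℝ) 1 := by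
    filter_upwards [hV0] with ω hω using hexp (le_min hω (by linarith))
  have hI2 : ∀ᵐ ω ∂μ, Real.exp (-(c * V ω)) ∈ Set.Icc (0 : ℝ) 1 := by
    filter_upwards [hV0] with ω hω using hexp hω
  have h2 := abs_integral_sub_le_measureReal (μ := μ) (S := bad K)
    (f := fun ω => Real.exp (-(c * min (V ω) K))) (g := fun ω => Real.exp (-(c * V ω)))
    (Integrable.of_mem_Icc 0 1 (Real.measurable_exp.comp_aemeasurable
      ((hVm.min aemeasurable_const).const_mul c).neg) hI1)
    (Integrable.of_mem_Icc 0 1 (Real.measurable_exp.comp_aemeasurable (hVm.const_mul c).neg) hI2)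
    (hbadm K) hI1 hI2 (by
      filter_upwards [hV] with ω hω hb
      rw [min_eq_left (le_of_tendsto' hω (hgood hb))])
  refine (abs_sub_le _ (∫ ω, ∏ i ∈ Finset.range (m n),
    (1 - truncAvoid ρ K (N n) i (fun i => X i ω) (X i ω)) ∂μ) _).trans_lt ?_
  refine (add_le_add h1 (abs_sub_le _ (∫ ω, Real.exp (-(c * min (V ω) K)) ∂μ) _)).trans_lt ?_
  linarith

end Limit

/-! ### Asymptotics of the weights at the scale `n ^ (1 / (ρ + 2))`. -/

theorem rpow_add_mul_le_rpow_add {b h q : ℝ} (hb : 0 < b) (hbh : 0 ≤ b + h) (hq : 1 ≤ q) :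
    b ^ q + q * h * b ^ (q - 1) ≤ (b + h) ^ q := by
  have h1 : -1 ≤ h / b := by rw [le_div_iff₀ hb]; linarith
  have h2 := one_add_mul_self_le_rpow_one_add h1 hq
  have h3 : b + h = b * (1 + h / b) := by field_simp
  rw [h3, Real.mul_rpow hb.le (by linarith), Real.rpow_sub hb, Real.rpow_one]
  have h4 := mul_le_mul_of_nonneg_left h2 (Real.rpow_pos_of_pos hb q).le
  refine le_trans (le_of_eq ?_) h4
  field_simp

/-- Discrete comparison with the integral of a power: Bernoulli's inequality at `m + 1` with
increments `1` and `-1` gives the two induction steps. -/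
theorem sum_rpow_bounds {p : ℝ} (hp : 0 ≤ p) (m : ℕ) :
    (m : ℝ) ^ (p + 1) ≤ (p + 1) * ∑ i ∈ Finset.range m, ((i : ℝ) + 1) ^ p ∧
    (p + 1) * ∑ i ∈ Finset.range m, ((i : ℝ) + 1) ^ p ≤ ((m : ℝ) + 1) ^ (p + 1) := by
  induction m with
  | zero => simp [Real.zero_rpow (show p + 1 ≠ 0 by linarith)]
  | succ m ih =>
    have hm : (0 : ℝ) < (m : ℝ) + 1 := by positivity
    have h1 := rpow_add_mul_le_rpow_add (h := 1) hm (by linarith) (show 1 ≤ p + 1 by linarith)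
    have h2 := rpow_add_mul_le_rpow_add (h := -1) hm (by simp) (show 1 ≤ p + 1 by linarith)
    rw [add_sub_cancel_right] at h1 h2
    rw [show (m : ℝ) + 1 + -1 = m by ring] at h2
    rw [Finset.sum_range_succ, mul_add]
    push_cast
    constructor <;> linarith [ih.1, ih.2]

theorem tendsto_sum_binWeight {ρ x : ℝ} (hρ : 0 < ρ) {N m : ℕ → ℕ}
    (hm : Tendsto (fun n : ℕ => (m n : ℝ) / (n : ℝ) ^ (1 / (ρ + 2))) atTop (𝓝 x))
    (hN : Tendsto (fun n : ℕ => (n : ℝ) / N n) atTop (𝓝 1)) :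
    Tendsto (fun n => ∑ i ∈ Finset.range (m n), binWeight ρ (N n) i) atTop
      (𝓝 (x ^ (ρ + 2) / (ρ * (ρ + 2)))) := by
  have hα : 0 < ρ + 2 := by linarith
  have hr : Tendsto (fun n : ℕ => (n : ℝ) ^ (1 / (ρ + 2))) atTop atTop :=
    (tendsto_rpow_atTop (by positivity)).comp tendsto_natCast_atTop_atTop
  have hm1 : Tendsto (fun n : ℕ => ((m n : ℝ) + 1) / (n : ℝ) ^ (1 / (ρ + 2))) atTop (𝓝 x) := by
    have := hm.add (tendsto_const_nhds (x := (1 : ℝ)).div_atTop hr)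
    simpa [add_div] using this
  have hscale {y : ℕ → ℝ} (hy0 : ∀ n, 0 ≤ y n)
      (hy : Tendsto (fun n : ℕ => y n / (n : ℝ) ^ (1 / (ρ + 2))) atTop (𝓝 x)) :
      Tendsto (fun n => y n ^ (ρ + 2) / N n / (ρ * (ρ + 2))) atTop
        (𝓝 (x ^ (ρ + 2) / (ρ * (ρ + 2)))) := by
    have h := ((hy.rpow_const (Or.inr hα.le)).mul hN).div_const (ρ * (ρ + 2))
    rw [mul_one] at h
    refine h.congr' ?_
    filter_upwards [eventually_gt_atTop 0] with n hn
    have hn' : (0 : ℝ) < n := by exact_mod_cast hn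
    rw [Real.div_rpow (hy0 n) (by positivity), ← Real.rpow_mul hn'.le,
      one_div_mul_cancel hα.ne', Real.rpow_one]
    field_simp
  have hsum (n : ℕ) : ∑ i ∈ Finset.range (m n), binWeight ρ (N n) i
      = ((ρ + 2) * ∑ i ∈ Finset.range (m n), ((i : ℝ) + 1) ^ (ρ + 1)) / N n / (ρ * (ρ + 2)) := by
    simp only [binWeight]
    rw [← Finset.sum_div]
    field_simp
  refine tendsto_of_tendsto_of_tendsto_of_le_of_le (hscale (fun n => Nat.cast_nonneg _) hm)
    (hscale (fun n => by positivity) hm1) (fun n => ?_) fun n => ?_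
  all_goals
    have h := sum_rpow_bounds (p := ρ + 1) (by linarith) (m n)
    rw [show ρ + 1 + 1 = ρ + 2 by ring] at h
    simp only [hsum]
  · have := h.1; gcongr
  · have := h.2; gcongr

theorem tendsto_rpow_div_zero {ρ x : ℝ} (hρ : 0 < ρ) {N m : ℕ → ℕ}
    (hm : Tendsto (fun n : ℕ => (m n : ℝ) / (n : ℝ) ^ (1 / (ρ + 2))) atTop (𝓝 x))
    (hN : Tendsto (fun n : ℕ => (n : ℝ) / N n) atTop (𝓝 1)) :
    Tendsto (fun n => (m n : ℝ) ^ (ρ + 1) / N n) atTop (𝓝 0) := by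
  have hα : 0 < ρ + 2 := by linarith
  have hr : Tendsto (fun n : ℕ => (n : ℝ) ^ (1 / (ρ + 2))) atTop atTop :=
    (tendsto_rpow_atTop (by positivity)).comp tendsto_natCast_atTop_atTop
  have h := ((hm.rpow_const (p := ρ + 1) (Or.inr (by linarith))).mul hr.inv_tendsto_atTop).mul hN
  rw [mul_zero, zero_mul] at h
  refine h.congr' ?_
  filter_upwards [eventually_gt_atTop 0] with n hn
  have hn' : (0 : ℝ) < n := by exact_mod_cast hn
  have e : (n : ℝ) = ((n : ℝ) ^ (1 / (ρ + 2))) ^ (ρ + 1) * (n : ℝ) ^ (1 / (ρ + 2)) := by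
    rw [← Real.rpow_mul hn'.le, ← Real.rpow_add hn',
      show 1 / (ρ + 2) * (ρ + 1) + 1 / (ρ + 2) = 1 by field_simp; ring, Real.rpow_one]
  have hr0 : 0 < (n : ℝ) ^ (1 / (ρ + 2)) := by positivity
  rw [Pi.inv_apply, Real.div_rpow (Nat.cast_nonneg _) hr0.le]
  nth_rewrite 3 [e]
  have := Real.rpow_pos_of_pos hr0 (ρ + 1)
  field_simp

theorem tendsto_ceil_sub_one_div {ρ x : ℝ} (hρ : 0 < ρ) (hx : 0 ≤ x) :
    Tendsto (fun n : ℕ => ((⌈x * (n : ℝ) ^ (1 / (ρ + 2))⌉₊ - 1 : ℕ) : ℝ)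
      / (n : ℝ) ^ (1 / (ρ + 2))) atTop (𝓝 x) := by
  have hr : Tendsto (fun n : ℕ => (n : ℝ) ^ (1 / (ρ + 2))) atTop atTop :=
    (tendsto_rpow_atTop (by positivity)).comp tendsto_natCast_atTop_atTop
  have hlow : Tendsto (fun n : ℕ => x - 1 / (n : ℝ) ^ (1 / (ρ + 2))) atTop (𝓝 x) := by
    have := (tendsto_const_nhds (x := x)).sub (tendsto_const_nhds (x := (1 : ℝ)).div_atTop hr)
    simpa using this
  refine tendsto_of_tendsto_of_tendsto_of_le_of_le' hlow tendsto_const_nhds ?_ ?_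
  all_goals
    filter_upwards [eventually_gt_atTop 0] with n hn
    have hr0 : 0 < (n : ℝ) ^ (1 / (ρ + 2)) := by positivity
    set y := x * (n : ℝ) ^ (1 / (ρ + 2)) with hy
    have hy0 : 0 ≤ y := by positivity
  · rw [le_div_iff₀ hr0, sub_mul, one_div_mul_cancel hr0.ne', ← hy]
    have h1 := Nat.le_ceil y
    have h2 : (⌈y⌉₊ : ℝ) ≤ ((⌈y⌉₊ - 1 : ℕ) : ℝ) + 1 := by exact_mod_cast (by omega : ⌈y⌉₊ ≤ ⌈y⌉₊ - 1 + 1)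
    linarith
  · rw [div_le_iff₀ hr0, ← hy]
    -- For `y = 0` the truncated subtraction yields `0`, which is harmless here.
    rcases Nat.eq_zero_or_pos ⌈y⌉₊ with h | h
    · rw [h]; simpa using hy0
    · rw [Nat.cast_sub h, Nat.cast_one]
      linarith [Nat.ceil_lt_add_one hy0]

theorem tendsto_sub_div {ρ x : ℝ} (hρ : 0 < ρ) {m : ℕ → ℕ}
    (hm : Tendsto (fun n : ℕ => (m n : ℝ) / (n : ℝ) ^ (1 / (ρ + 2))) atTop (𝓝 x)) :
    Tendsto (fun n : ℕ => ((n - m n : ℕ) : ℝ) / n) atTop (𝓝 1) := by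
  have hneg : Tendsto (fun n : ℕ => (n : ℝ) ^ (-((ρ + 1) / (ρ + 2)))) atTop (𝓝 0) :=
    (tendsto_rpow_neg_atTop (by positivity)).comp tendsto_natCast_atTop_atTop
  have h0 : Tendsto (fun n : ℕ => (m n : ℝ) / n) atTop (𝓝 0) := by
    have := hm.mul hneg
    rw [mul_zero] at this
    refine this.congr' ?_
    filter_upwards [eventually_gt_atTop 0] with n hn
    have hn' : (0 : ℝ) < n := by exact_mod_cast hn
    rw [div_mul_eq_mul_div, mul_div_assoc, ← Real.rpow_sub hn',
      show -((ρ + 1) / (ρ + 2)) - 1 / (ρ + 2) = -1 by field_simp; ring, Real.rpow_neg_one,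
      div_eq_mul_inv]
  have h1 : Tendsto (fun n : ℕ => 1 - (m n : ℝ) / n) atTop (𝓝 1) := by
    simpa using h0.const_sub 1
  refine h1.congr' ?_
  filter_upwards [eventually_gt_atTop 0, h0.eventually (gt_mem_nhds one_pos)] with n hn hlt
  have hn' : (0 : ℝ) < n := by exact_mod_cast hn
  rw [div_lt_one hn'] at hlt
  have : m n ≤ n := by exact_mod_cast hlt.le
  rw [Nat.cast_sub this, sub_div, div_self hn'.ne']

/-! ### From the first empty bin to occupancy, and the conclusion. -/

theorem splitTime_eq_splitSum {Ω : Type*} {E : ℕ → Ω → ℝ} {ω : Ω} (h : ∀ i, 0 ≤ E i ω) (n : ℕ) :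
    splitTime E n ω = splitSum (fun i => E i ω) n :=
  Finset.sum_congr rfl fun i _ => by rw [abs_of_nonneg (h i)]

/-- The bins, indexed from `0`. -/
def splitBin (e : ℕ → ℝ) (i : ℕ) : Set ℝ := Set.Ioc (splitSum e i) (splitSum e (i + 1))

theorem pairwise_disjoint_splitBin (e : ℕ → ℝ) :
    Pairwise (Function.onFun Disjoint (splitBin e)) :=
  (splitSum_mono e).pairwise_disjoint_on_Ioc_succ

theorem lt_firstEmptyBin_iff {Ω : Type*} {E B : ℕ → Ω → ℝ} {ω : Ω} (h : ∀ i, 0 ≤ E i ω)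
    (n m : ℕ) :
    m < firstEmptyBin E B n ω ↔
      ∀ i ∈ Finset.range m, ∃ j < n, B j ω ∈ splitBin (fun i => E i ω) i := by
  set S : Set ℕ := {i : ℕ | 1 ≤ i ∧ ∀ j < n, B j ω ∉ bin E i ω} with hS
  have hbin (i : ℕ) : bin E (i + 1) ω = splitBin (fun i => E i ω) i := by
    simp only [bin, splitBin, splitTime_eq_splitSum h, Nat.add_sub_cancel]
  -- Pigeonhole: if every bin were occupied, choosing a ball in each would inject `ℕ` into `Fin n`.
  -- This excludes the default value `sInf ∅ = 0`.
  have hne : S.Nonempty := by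
    by_contra hemp
    have hall (i : ℕ) : ∃ j : Fin n, B j ω ∈ splitBin (fun i => E i ω) i := by
      by_contra hi
      refine hemp ⟨i + 1, by omega, fun j hj hjB => hi ⟨⟨j, hj⟩, ?_⟩⟩
      rwa [hbin] at hjB
    choose f hf using hall
    refine not_injective_infinite_finite f fun i i' hii' => ?_
    by_contra hne
    have h1 := hf i'
    rw [← hii'] at h1
    exact Set.disjoint_left.1 (pairwise_disjoint_splitBin _ hne) (hf i) h1
  have hmem : firstEmptyBin E B n ω ∈ S := Nat.sInf_mem hne
  constructor
  · intro hlt i hi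
    by_contra hno
    have : i + 1 ∈ S := by
      refine ⟨by omega, fun j hj hjB => hno ⟨j, hj, ?_⟩⟩
      rwa [hbin] at hjB
    have h1 : firstEmptyBin E B n ω ≤ i + 1 := Nat.sInf_le this
    have := Finset.mem_range.1 hi
    omega
  · intro hall
    by_contra hle
    obtain ⟨i, hi⟩ : ∃ i, firstEmptyBin E B n ω = i + 1 := ⟨_, (Nat.sub_add_cancel hmem.1).symm⟩
    obtain ⟨j, hj, hjB⟩ := hall i (Finset.mem_range.2 (by omega))
    refine hmem.2 j hj ?_
    rwa [hi, hbin]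

theorem le_div_firstEmptyBin_iff {Ω : Type*} {E B : ℕ → Ω → ℝ} {ω : Ω} (h : ∀ i, 0 ≤ E i ω)
    (n : ℕ) {x r : ℝ} (hr : 0 < r) :
    x ≤ (firstEmptyBin E B n ω : ℝ) / r ↔
      ∀ i ∈ Finset.range (⌈x * r⌉₊ - 1), ∃ j < n, B j ω ∈ splitBin (fun i => E i ω) i := by
  rw [← lt_firstEmptyBin_iff h, le_div_iff₀ hr, ← Nat.ceil_le]
  -- Positivity makes `⌈x * r⌉₊ - 1 < ν` equivalent to `⌈x * r⌉₊ ≤ ν` even when the ceiling is `0`.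
  have : 0 < firstEmptyBin E B n ω := (lt_firstEmptyBin_iff h n 0).2 (by simp)
  omega

/-- Independent families may be sampled on separate copies of the probability space. -/
theorem ProbabilityTheory.IndepFun.measureReal_eq_integral {Ω α β : Type*} [MeasurableSpace Ω]
    [MeasurableSpace α] [MeasurableSpace β] {μ : Measure Ω} [IsProbabilityMeasure μ] {X : Ω → α}
    {Y : Ω → β} (h : IndepFun X Y μ) (hX : Measurable X) (hY : Measurable Y)
    {G : Set (α × β)} (hG : MeasurableSet G) :
    Measurable (fun ω => μ.real {ω' | (X ω, Y ω') ∈ G}) ∧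
    μ.real {ω | (X ω, Y ω) ∈ G} = ∫ ω, μ.real {ω' | (X ω, Y ω') ∈ G} ∂μ := by
  have hlaw := (indepFun_iff_map_prod_eq_prod_map_map hX.aemeasurable hY.aemeasurable).1 h
  have : IsProbabilityMeasure (μ.map Y) := Measure.isProbabilityMeasure_map hY.aemeasurable
  have hsec (a : α) : μ.map Y (Prod.mk a ⁻¹' G) = μ {ω' | (a, Y ω') ∈ G} :=
    Measure.map_apply hY (measurable_prodMk_left hG)
  have hmeas : Measurable fun a => μ {ω' | (a, Y ω') ∈ G} := by
    simp_rw [← hsec]; exact measurable_measure_prodMk_left hG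
  refine ⟨(hmeas.comp hX).ennreal_toReal, ?_⟩
  have h1 : μ {ω | (X ω, Y ω) ∈ G} = ∫⁻ ω, μ {ω' | (X ω, Y ω') ∈ G} ∂μ := by
    have h2 := Measure.map_apply (μ := μ) (hX.prodMk hY) hG
    rw [hlaw, Measure.prod_apply hG, lintegral_map (measurable_measure_prodMk_left hG) hX] at h2
    simp_rw [hsec] at h2
    exact h2.symm
  simp only [measureReal_def]
  rw [h1]
  exact (integral_toReal (hmeas.comp hX).aemeasurable
    (ae_of_all _ fun _ => measure_lt_top _ _)).symm

theorem measurableSet_occupied (n m : ℕ) :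
    MeasurableSet {p : (ℕ → ℝ) × (ℕ → ℝ) |
      ∀ i ∈ Finset.range m, ∃ j < n, p.2 j ∈ splitBin p.1 i} := by
  have h (i j : ℕ) : MeasurableSet {p : (ℕ → ℝ) × (ℕ → ℝ) | p.2 j ∈ splitBin p.1 i} := by
    have h1 (k : ℕ) : Measurable fun p : (ℕ → ℝ) × (ℕ → ℝ) => splitSum p.1 k :=
      (measurable_splitSum k).comp measurable_fst
    have h2 : Measurable fun p : (ℕ → ℝ) × (ℕ → ℝ) => p.2 j :=
      (measurable_pi_apply j).comp measurable_snd
    exact (measurableSet_lt (h1 i) h2).inter (measurableSet_le h2 (h1 (i + 1)))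
  have e : {p : (ℕ → ℝ) × (ℕ → ℝ) | ∀ i ∈ Finset.range m, ∃ j < n, p.2 j ∈ splitBin p.1 i}
      = ⋂ i ∈ Finset.range m, ⋃ j ∈ Finset.range n,
        {p : (ℕ → ℝ) × (ℕ → ℝ) | p.2 j ∈ splitBin p.1 i} := by
    ext p; simp
  rw [e]
  exact Finset.measurableSet_biInter _ fun i _ => Finset.measurableSet_biUnion _ fun j _ => h i j

/-- Independence of the two sequences allows the bins to be frozen; the product bounds hold for each
fixed sequence of bins and are then integrated. -/
theorem measureReal_occupied_bounds {Ω : Type*} [MeasurableSpace Ω] {μ : Measure Ω}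
    [IsProbabilityMeasure μ] {ρ : ℝ} (hρ : 0 < ρ) {E B : ℕ → Ω → ℝ}
    (hE_meas : ∀ i, Measurable (E i)) (hB_meas : ∀ j, Measurable (B j))
    (hB_law : ∀ j, HasLaw (B j) (expMeasure ρ) μ) (hB_indep : iIndepFun B μ)
    (hEB_indep : IndepFun (fun ω i => E i ω) (fun ω j => B j ω) μ) (n m : ℕ) :
    ∫ ω, ∏ i ∈ Finset.range m, (1 - (1 - binProb ρ (fun i => E i ω) i) ^ (n - m)) ∂μ
      ≤ μ.real {ω | ∀ i ∈ Finset.range m, ∃ j < n, B j ω ∈ splitBin (fun i => E i ω) i} ∧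
    μ.real {ω | ∀ i ∈ Finset.range m, ∃ j < n, B j ω ∈ splitBin (fun i => E i ω) i}
      ≤ ∫ ω, ∏ i ∈ Finset.range m, (1 - (1 - binProb ρ (fun i => E i ω) i) ^ n) ∂μ := by
  obtain ⟨hmeas, heq⟩ := hEB_indep.measureReal_eq_integral (measurable_pi_lambda _ hE_meas)
    (measurable_pi_lambda _ hB_meas) (measurableSet_occupied n m)
  have hb (ω : Ω) := measureReal_hitSet_range_bounds (μ := μ) (A := splitBin fun i => E i ω)
    (p := binProb ρ fun i => E i ω) hB_meas (fun i => measurableSet_Ioc) hB_indep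
    (pairwise_disjoint_splitBin _)
    (fun j i => by
      rw [splitBin, ← map_measureReal_apply (hB_meas j) measurableSet_Ioc, (hB_law j).map_eq]
      exact expMeasure_real_Ioc hρ (splitSum_nonneg _ _) (splitSum_mono _ (Nat.le_succ i))) n m
  have hint := integrable_of_measurable_of_abs_le (μ := μ) (C := 1) hmeas fun ω => by
    rw [abs_of_nonneg measureReal_nonneg]; exact measureReal_le_one
  have heq' : μ.real {ω | ∀ i ∈ Finset.range m, ∃ j < n, B j ω ∈ splitBin (fun i => E i ω) i}
      = _ := heq
  rw [heq']
  exact ⟨integral_mono (integrable_prod_binProb hE_meas hρ _ _) hint fun ω => (hb ω).1,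
    integral_mono hint (integrable_prod_binProb hE_meas hρ _ _) fun ω => (hb ω).2⟩

/-- The weight is `exp (ρ (M_i - (log (i + 1) - log i)))`, and the logarithmic increment vanishes in
the limit. -/
theorem tendsto_invWeight {Ω : Type*} {E : ℕ → Ω → ℝ} {ω : Ω} (h : ∀ i, 0 ≤ E i ω) (ρ : ℝ)
    (hlim : Tendsto (fun n => centeredSplitTime E n ω) atTop (𝓝 (centeredSplitTimeLimit E ω))) :
    Tendsto (fun i => invWeight ρ i fun i => E i ω) atTop (𝓝 (wInfinity E ω ^ (-ρ))) := by
  have h1 := ((hlim.sub Real.tendsto_log_nat_add_one_sub_log).const_mul ρ).rexp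
  have e : Real.exp (ρ * (centeredSplitTimeLimit E ω - 0)) = wInfinity E ω ^ (-ρ) := by
    rw [wInfinity, ← Real.exp_mul]; ring_nf
  rw [e] at h1
  refine h1.congr fun i => ?_
  have hi : (0 : ℝ) < (i : ℝ) + 1 := by positivity
  rw [invWeight, Real.rpow_def_of_pos hi, ← Real.exp_add, centeredSplitTime,
    splitTime_eq_splitSum h]
  ring_nf

theorem mainTheorem6 {Ω : Type*} [MeasurableSpace Ω] (μ : Measure Ω) [IsProbabilityMeasure μ]
    (ρ : ℝ) (hρ : 0 < ρ) (E B : ℕ → Ω → ℝ)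
    (hE_meas : ∀ i, Measurable (E i)) (hB_meas : ∀ j, Measurable (B j))
    (hE_law : ∀ i, HasLaw (E i) (expMeasure 1) μ)
    (hB_law : ∀ j, HasLaw (B j) (expMeasure ρ) μ)
    (hE_indep : iIndepFun E μ) (hB_indep : iIndepFun B μ)
    (hEB_indep : IndepFun (fun ω i => E i ω) (fun ω j => B j ω) μ) :
    (∀ᵐ ω ∂μ, Tendsto (fun n : ℕ => centeredSplitTime E n ω) atTop
      (𝓝 (centeredSplitTimeLimit E ω))) ∧
    ∀ x : ℝ, 0 ≤ x →
      Tendsto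
        (fun n : ℕ =>
          μ.real {ω | x ≤ (firstEmptyBin E B n ω : ℝ) / (n : ℝ) ^ (1 / (ρ + 2))})
        atTop
        (𝓝 (∫ ω, Real.exp (-(x ^ (ρ + 2) * wInfinity E ω ^ (-ρ) / (ρ * (ρ + 2)))) ∂μ)) := by
  have hlim : ∀ᵐ ω ∂μ, Tendsto (fun n : ℕ => centeredSplitTime E n ω) atTop
      (𝓝 (centeredSplitTimeLimit E ω)) := by
    filter_upwards [ae_exists_tendsto_centeredSplitTime hE_indep hE_meas hE_law] with ω hω
    exact tendsto_nhds_limUnder hω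
  refine ⟨hlim, fun x hx => ?_⟩
  have hnonneg : ∀ᵐ ω ∂μ, ∀ i, 0 ≤ E i ω := by
    refine ae_all_iff.2 fun i => ?_
    have := ae_pos_expMeasure one_pos
    rw [← (hE_law i).map_eq] at this
    filter_upwards [ae_of_ae_map (hE_meas i).aemeasurable this] with ω hω using hω.le
  have hV : ∀ᵐ ω ∂μ, Tendsto (fun i => invWeight ρ i fun i => E i ω) atTop
      (𝓝 (wInfinity E ω ^ (-ρ))) := by
    filter_upwards [hlim, hnonneg] with ω h1 h2 using tendsto_invWeight h2 ρ h1
  set m : ℕ → ℕ := fun n => ⌈x * (n : ℝ) ^ (1 / (ρ + 2))⌉₊ - 1 with hm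
  have hmx := tendsto_ceil_sub_one_div hρ hx
  have key {N : ℕ → ℕ} (hN : Tendsto (fun n : ℕ => (N n : ℝ) / n) atTop (𝓝 1)) :
      Tendsto (fun n => ∫ ω, ∏ i ∈ Finset.range (m n),
        (1 - (1 - binProb ρ (fun i => E i ω) i) ^ (N n)) ∂μ) atTop
        (𝓝 (∫ ω, Real.exp (-(x ^ (ρ + 2) / (ρ * (ρ + 2)) * wInfinity E ω ^ (-ρ))) ∂μ)) := by
    have hN' : Tendsto (fun n : ℕ => (n : ℝ) / N n) atTop (𝓝 1) := by
      simpa using hN.inv₀ one_ne_zero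
    have hNtop : Tendsto N atTop atTop := by
      refine tendsto_natCast_atTop_iff (R := ℝ).1
        ((hN.pos_mul_atTop one_pos tendsto_natCast_atTop_atTop).congr' ?_)
      filter_upwards [eventually_gt_atTop 0] with n hn
      have hn' : (n : ℝ) ≠ 0 := by exact_mod_cast hn.ne'
      field_simp
    exact tendsto_integral_prod_binProb hE_indep hE_meas (fun i => (hE_law i).map_eq) hρ hV hNtop
      (tendsto_sum_binWeight hρ hmx hN') (tendsto_rpow_div_zero hρ hmx hN')
  have hid : Tendsto (fun n : ℕ => (n : ℝ) / n) atTop (𝓝 1) := by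
    refine tendsto_const_nhds.congr' ?_
    filter_upwards [eventually_gt_atTop 0] with n hn
    have hn' : (n : ℝ) ≠ 0 := by exact_mod_cast hn.ne'
    rw [div_self hn']
  simp_rw [mul_div_right_comm]
  -- Squeeze between the products with `n - m n` and `n` balls, both counts being asymptotic to `n`.
  refine tendsto_of_tendsto_of_tendsto_of_le_of_le' (key (tendsto_sub_div hρ hmx)) (key hid) ?_ ?_
  all_goals
    filter_upwards [eventually_gt_atTop 0] with n hn
    have hr : (0 : ℝ) < (n : ℝ) ^ (1 / (ρ + 2)) := by
      have : (0 : ℝ) < n := by exact_mod_cast hn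
      positivity
    have hb := measureReal_occupied_bounds hρ hE_meas hB_meas hB_law hB_indep hEB_indep n (m n)
    have heq : μ.real {ω | x ≤ (firstEmptyBin E B n ω : ℝ) / (n : ℝ) ^ (1 / (ρ + 2))}
        = μ.real {ω | ∀ i ∈ Finset.range (m n), ∃ j < n,
          B j ω ∈ splitBin (fun i => E i ω) i} := by
      refine measureReal_congr ?_
      filter_upwards [hnonneg] with ω hω
      exact propext (le_div_firstEmptyBin_iff hω n hr)
    rw [heq]
  · exact hb.1
  · exact hb.2
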